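/- **Lemma (Invariant symmetric polynomials for $D_l$).** Let $l\ge 1$, let $\mathfrak g=\mathfrak{so}(2l)$ be the real Lie algebra of skew-symmetric $2l\times 2l$ matrices, and let $(X_i)$ be any basis of $\mathfrak g$, with structure constants $[X_\nu,X_i]=C_{\nu i}^{\rho}X_\rho$. A tensor $h_{i_1\dots i_m}$ of order $m$ is *symmetric* if it is unchanged by permutations of its indices, and *invariant* if $\sum_{s=1}^m C_{\nu i_s}^{\rho}\,h_{i_1\dots i_{s-1}\rho\, i_{s+1}\dots i_m}=0$ for all $\nu,i_1,\dots,i_m$. Round brackets denote symmetrisation with unit weight (factor $1/m!$). An invariant symmetric tensor of order $m\ge1$ is *primitive* if it is not a linear combination of symmetrised products $h_{(i_1\dots i_p}h'_{i_{p+1}\dots i_m)}$ of invariant symmetric tensors of orders $p\ge1$ and $m-p\ge1$. Put $$k^{(m)}_{i_1\dots i_m}=\mathrm{Tr}\big(X_{(i_1}\cdots X_{i_m)}\big),\qquad \mathrm{Pf}(A)=\frac1{2^l\,l!}\sum_{\sigma\in S_{2l}}\mathrm{sgn}(\sigma)\prod_{s=1}^{l}A_{\sigma(2s-1)\,\sigma(2s)},$$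 $$\mathrm{Pf}_{i_1\dots i_l}=\frac1{2^l\,l!}\sum_{\sigma\in S_{2l}}\mathrm{sgn}(\sigma)\prod_{s=1}^{l}(X_{i_s})_{\sigma(2s-1)\,\sigma(2s)},$$ $$\epsilon_{\alpha_1\dots\alpha_n}^{\beta_1\dots\beta_n}=\sum_{\sigma\in S_n}\mathrm{sgn}(\sigma)\,\delta_{\alpha_1}^{\beta_{\sigma(1)}}\cdots\delta_{\alpha_n}^{\beta_{\sigma(n)}}.$$ Then: 1. Every $k^{(m)}$ is an invariant symmetric tensor, and $k^{(m)}=0$ for odd $m$. 2. For $m\ge 1$, $k^{(m)}$ is primitive if and only if $m\in\{2,4,\dots,2l-2\}$. 3. $(\mathrm{Pf}_{i_1\dots i_l})$ is an invariant symmetric tensor, and $\mathrm{Pf}(\lambda^iX_i)=\mathrm{Pf}_{i_1\dots i_l}\lambda^{i_1}\cdots\lambda^{i_l}$ for all real $\lambda^i$. 4. For every even $m\ge 2l$, $k^{(m)}$ is a linear combination of symmetrised products, of total order $m$, of the tensors $k^{(2)},k^{(4)},\dots,k^{(2l-2)}$ and $\mathrm{Pf}$. 5. $\det(\lambda^iX_i)=\big(\mathrm{Pf}(\lambda^iX_i)\big)^2$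 for all real $\lambda^i$, and, for all $i_1,\dots,i_{2l}$, $$\epsilon_{\alpha_1\dots\alpha_{2l}}^{\beta_1\dots\beta_{2l}}(X_{i_1})^{\alpha_1}_{\ \beta_1}\cdots(X_{i_{2l}})^{\alpha_{2l}}_{\ \beta_{2l}}=(2l)!\;\mathrm{Pf}_{(i_1\dots i_l}\,\mathrm{Pf}_{i_{l+1}\dots i_{2l})}$$ (repeated indices are summed; equivalently, the unit-weight antisymmetrisation $\frac1{(2l)!}\epsilon\,X\cdots X$ equals $\mathrm{Pf}_{(i_1\dots i_l}\mathrm{Pf}_{i_{l+1}\dots i_{2l})}$). -/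

import Mathlib

noncomputable section

namespace EvenOrthogonal

attribute [local instance 100] LieRing.ofAssociativeRing

/-- The Lie algebra `so(2l)` of real skew-symmetric `2l × 2l` matrices, with the commutator. -/
abbrev D (l : ℕ) : LieSubalgebra ℝ (Matrix (Fin (2 * l)) (Fin (2 * l)) ℝ) :=
  LieAlgebra.Orthogonal.so (Fin (2 * l)) ℝ

/-- Coordinates `h_{i_1 … i_m}` of a covariant tensor of order `m`, with respect to a basis
indexed by `ι`. -/
abbrev Tensor (ι : Type*) (m : ℕ) : Type _ := (Fin m → ι) → ℝ

section General

variable {ι : Type*} {𝔤 : Type*} [LieRing 𝔤] [LieAlgebra ℝ 𝔤]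

/-- The structure constants `C_{νi}^ρ` of a basis: `⁅X_ν, X_i⁆ = ∑_ρ C_{νi}^ρ X_ρ`. -/
def structureConst (X : Module.Basis ι ℝ 𝔤) (ν i ρ : ι) : ℝ := X.repr ⁅X ν, X i⁆ ρ

def IsSymmetric {m : ℕ} (h : Tensor ι m) : Prop :=
  ∀ (σ : Equiv.Perm (Fin m)) (i : Fin m → ι), h (i ∘ σ) = h i

/-- Invariance of a tensor: `∑_s C_{ν i_s}^ρ h_{i_1 … ρ … i_m} = 0`, where `ρ` is at position `s`
and is summed over. -/
def IsInvariant [Fintype ι] (X : Module.Basis ι ℝ 𝔤) {m : ℕ} (h : Tensor ι m) : Prop :=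
  ∀ (ν : ι) (i : Fin m → ι),
    ∑ s, ∑ ρ, structureConst X ν (i s) ρ * h (Function.update i s ρ) = 0

/-- The symmetrised product `h_{(i_1 … i_p} h'_{i_{p+1} … i_{p+q})}` with unit weight, of order
`m = p + q`. -/
def symProd {p q m : ℕ} (e : p + q = m) (h : Tensor ι p) (h' : Tensor ι q) : Tensor ι m :=
  fun i => (1 / (m.factorial : ℝ)) * ∑ σ : Equiv.Perm (Fin m),
    h (fun s => i (σ (Fin.cast e (Fin.castAdd q s)))) *
      h' (fun s => i (σ (Fin.cast e (Fin.natAdd p s))))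

/-- The linear span of the symmetrised products of two invariant symmetric tensors of positive
orders adding up to `m` (so each of order lower than `m`). -/
def decomposable [Fintype ι] (X : Module.Basis ι ℝ 𝔤) (m : ℕ) : Submodule ℝ (Tensor ι m) :=
  Submodule.span ℝ {t | ∃ (p q : ℕ) (e : p + q = m) (h : Tensor ι p) (h' : Tensor ι q),
    0 < p ∧ 0 < q ∧ IsSymmetric h ∧ IsInvariant X h ∧ IsSymmetric h' ∧ IsInvariant X h' ∧
      t = symProd e h h'}

/-- An invariant symmetric tensor is primitive if it is not a linear combination of symmetrised
products of invariant symmetric tensors of lower order. -/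
def IsPrimitive [Fintype ι] (X : Module.Basis ι ℝ 𝔤) {m : ℕ} (h : Tensor ι m) : Prop :=
  IsSymmetric h ∧ IsInvariant X h ∧ h ∉ decomposable X m

/-- `GeneratedBy S m t`: the tensor `t` of order `m` is a linear combination of symmetrised
products (with one or more factors, of total order `m`) of members of the family `S`. -/
inductive GeneratedBy (S : Set (Σ m : ℕ, Tensor ι m)) : ∀ m : ℕ, Tensor ι m → Prop
  | of {m : ℕ} {t : Tensor ι m} : (⟨m, t⟩ : Σ m : ℕ, Tensor ι m) ∈ S → GeneratedBy S m t
  | zero (m : ℕ) : GeneratedBy S m 0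
  | add {m : ℕ} {t t' : Tensor ι m} :
      GeneratedBy S m t → GeneratedBy S m t' → GeneratedBy S m (t + t')
  | smul {m : ℕ} (c : ℝ) {t : Tensor ι m} : GeneratedBy S m t → GeneratedBy S m (c • t)
  | mul {p q m : ℕ} (e : p + q = m) {t : Tensor ι p} {t' : Tensor ι q} :
      GeneratedBy S p t → GeneratedBy S q t' → GeneratedBy S m (symProd e t t')

end General

/-- The generalised Kronecker symbol
`ε_{α_1 … α_n}^{β_1 … β_n} = ∑_σ (-1)^{π(σ)} δ_{α_1}^{β_{σ(1)}} … δ_{α_n}^{β_{σ(n)}}`. -/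
def epsilon {κ : Type*} [DecidableEq κ] {n : ℕ} (α β : Fin n → κ) : ℝ :=
  ∑ σ : Equiv.Perm (Fin n), ((Equiv.Perm.sign σ : ℤ) : ℝ) *
    ∏ s, if α s = β (σ s) then (1 : ℝ) else 0

/-- The Pfaffian `1/(2^l l!) ∑_σ (-1)^{π(σ)} ∏_{s=1}^l A_{σ(2s-1) σ(2s)}` of a `2l × 2l` matrix. -/
def pfaffian {l : ℕ} (A : Matrix (Fin (2 * l)) (Fin (2 * l)) ℝ) : ℝ :=
  (1 / ((2 : ℝ) ^ l * (l.factorial : ℝ))) * ∑ σ : Equiv.Perm (Fin (2 * l)),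
    ((Equiv.Perm.sign σ : ℤ) : ℝ) *
      ∏ s : Fin l, A (σ ⟨2 * s.val, by omega⟩) (σ ⟨2 * s.val + 1, by omega⟩)

section EvenOrthogonal

variable {ι : Type*} {l : ℕ}

/-- The symmetric trace `k_{i_1 … i_m} = Tr (X_{(i_1} … X_{i_m)})`, with unit weight, in the
defining representation. -/
def symTrace (X : Module.Basis ι ℝ (D l)) (m : ℕ) : Tensor ι m :=
  fun i => (1 / (m.factorial : ℝ)) * ∑ σ : Equiv.Perm (Fin m),
    Matrix.trace
      (List.ofFn fun s => (X (i (σ s)) : Matrix (Fin (2 * l)) (Fin (2 * l)) ℝ)).prod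

/-- The Pfaffian tensor `Pf_{i_1 … i_l}`: the coordinates of the complete polarisation of the
Pfaffian, obtained by putting the `s`-th generator in the `s`-th factor. -/
def pfTensor (X : Module.Basis ι ℝ (D l)) : Tensor ι l :=
  fun i => (1 / ((2 : ℝ) ^ l * (l.factorial : ℝ))) * ∑ σ : Equiv.Perm (Fin (2 * l)),
    ((Equiv.Perm.sign σ : ℤ) : ℝ) *
      ∏ s : Fin l, (X (i s) : Matrix (Fin (2 * l)) (Fin (2 * l)) ℝ)
        (σ ⟨2 * s.val, by omega⟩) (σ ⟨2 * s.val + 1, by omega⟩)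

/-- The element `λ^i X_i` of `so(2l)`, as a matrix. -/
def combo [Fintype ι] (X : Module.Basis ι ℝ (D l)) (c : ι → ℝ) :
    Matrix (Fin (2 * l)) (Fin (2 * l)) ℝ :=
  ∑ i, c i • (X i : Matrix (Fin (2 * l)) (Fin (2 * l)) ℝ)

/-- The symmetric traces of orders `2, 4, …, 2l - 2` together with the Pfaffian tensor. -/
def basicTensors (X : Module.Basis ι ℝ (D l)) : Set (Σ m : ℕ, Tensor ι m) :=
  {T | ∃ m : ℕ, Even m ∧ 2 ≤ m ∧ m ≤ 2 * l - 2 ∧ T = ⟨m, symTrace X m⟩} ∪ {⟨l, pfTensor X⟩}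

end EvenOrthogonal

end EvenOrthogonal

end

/-! A symmetric tensor is determined by its homogeneous polynomial, and symmetrised products become
products of polynomials (`IsSymmetric.ext`, `toPoly_symProd`). With A = λ^i X_i, the trace tensors
become Tr A^m, the Pfaffian tensor becomes Pf(A) and the antisymmetrised product becomes (2l)! det
A, so the tensor identities reduce to identities for skew-symmetric matrices.

A skew-symmetric A is a sum of l bivectors, that is, A = P J Pᵀ with J block diagonal of determinant
1. Hence det A = (det P)², while multilinear expansion gives Pf(A) = det P (`det_eq_pfaffian_sq`).
In Newton's identities the elementary symmetric function E_{2l} is then Pf(A)², and E_k = 0 for k >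
2l. So every trace of order at least 2l is generated by the lower traces and Pf
(`trace_pow_mem_generatedPoly`). All these generators have order below 2l, so such traces are
decomposable.

For primitivity in order 2j < 2l, invariant polynomials are complexified and restricted to the
Cartan subalgebra, where permutations and even sign changes of the coordinates preserve them. Let η
be a primitive 2j-th root of unity. Some Weyl element multiplies (1, η, …, η^{j-1}, 0, …, 0) by η,
so invariants of degree strictly between 0 and 2j vanish there (`IsInvariant.toPoly_cyclicPoint`).
All products of total order 2j vanish too, but Tr A^{2j} takes the value 2j(-1)^j. The Weyl symmetry
itself comes from integrating infinitesimal invariance along one-parameter rotations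
(`IsInvariant.toPoly_reflection`). -/

noncomputable section

namespace EvenOrthogonal

attribute [local instance 100] LieRing.ofAssociativeRing

/-! ### Symmetric tensors as homogeneous polynomials. -/

section TensorAlgebra

variable {ι : Type*} [Fintype ι] {K : Type*} [CommRing K] [Algebra ℝ K]

/-- The homogeneous polynomial function of a tensor, on vectors with coordinates in `K`. -/
def toPoly {m : ℕ} (h : Tensor ι m) (c : ι → K) : K :=
  ∑ i, algebraMap ℝ K (h i) * ∏ s, c (i s)

lemma toPoly_zero {m : ℕ} (c : ι → K) : toPoly (0 : Tensor ι m) c = 0 := by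
  simp [toPoly]

lemma toPoly_add {m : ℕ} (h h' : Tensor ι m) (c : ι → K) :
    toPoly (h + h') c = toPoly h c + toPoly h' c := by
  simp [toPoly, add_mul, Finset.sum_add_distrib]

lemma toPoly_smul {m : ℕ} (r : ℝ) (h : Tensor ι m) (c : ι → K) :
    toPoly (r • h) c = algebraMap ℝ K r * toPoly h c := by
  simp [toPoly, mul_assoc, Finset.mul_sum]

lemma toPoly_smul_right {m : ℕ} (h : Tensor ι m) (z : K) (c : ι → K) :
    toPoly h (z • c) = z ^ m * toPoly h c := by
  simp only [toPoly, Pi.smul_apply, smul_eq_mul, Finset.prod_mul_distrib, Finset.prod_const,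
    Finset.card_univ, Fintype.card_fin, Finset.mul_sum]
  exact Finset.sum_congr rfl fun i _ => by ring

/-- The polynomial function of a symmetrisation is that of the tensor itself. -/
lemma toPoly_symmetrization {m : ℕ} (h : Tensor ι m) (c : ι → K) :
    toPoly (fun i => (1 / (m.factorial : ℝ)) * ∑ σ : Equiv.Perm (Fin m), h (i ∘ σ)) c =
      toPoly h c := by
  have key : ∀ σ : Equiv.Perm (Fin m),
      ∑ i : Fin m → ι, algebraMap ℝ K (h (i ∘ σ)) * ∏ s, c (i s) = toPoly h c := by
    intro σ
    refine Fintype.sum_equiv (σ.symm.arrowCongr (Equiv.refl ι)) _ _ fun i => ?_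
    have : (σ.symm.arrowCongr (Equiv.refl ι)) i = i ∘ σ := rfl
    rw [this]
    congr 1
    exact (Equiv.prod_comp σ fun s => c (i s)).symm
  have hm : (m.factorial : ℝ) ≠ 0 := by positivity
  calc _ = algebraMap ℝ K (1 / m.factorial) * ∑ σ : Equiv.Perm (Fin m),
        ∑ i : Fin m → ι, algebraMap ℝ K (h (i ∘ σ)) * ∏ s, c (i s) := by
        rw [Finset.sum_comm, toPoly, Finset.mul_sum]
        refine Finset.sum_congr rfl fun i _ => ?_
        rw [map_mul, map_sum, mul_assoc, Finset.sum_mul]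
    _ = algebraMap ℝ K (1 / m.factorial) * (algebraMap ℝ K m.factorial * toPoly h c) := by
        simp [key, Fintype.card_perm]
    _ = toPoly h c := by
        rw [← mul_assoc, ← map_mul, one_div_mul_cancel hm, map_one, one_mul]

/-- The tensor product `h_{i_1 … i_p} h'_{i_{p+1} … i_{p+q}}`. -/
def outerProd {ι : Type*} {p q : ℕ} (h : Tensor ι p) (h' : Tensor ι q) : Tensor ι (p + q) :=
  fun j => h (fun s => j (Fin.castAdd q s)) * h' (fun s => j (Fin.natAdd p s))

lemma toPoly_outerProd {p q : ℕ} (h : Tensor ι p) (h' : Tensor ι q) (c : ι → K) :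
    toPoly (outerProd h h') c = toPoly h c * toPoly h' c := by
  simp only [toPoly]
  rw [Finset.sum_mul_sum, ← Fintype.sum_prod_type']
  refine (Fintype.sum_equiv (Fin.appendEquiv p q) _ _ fun x => ?_).symm
  simp only [outerProd, Fin.appendEquiv, Equiv.coe_fn_mk, Fin.append_left, Fin.append_right,
    Fin.prod_univ_add, map_mul]
  ring

lemma symProd_rfl {ι : Type*} {p q : ℕ} (h : Tensor ι p) (h' : Tensor ι q) :
    symProd rfl h h' = fun i : Fin (p + q) → ι => (1 / ((p + q).factorial : ℝ)) *
      ∑ σ : Equiv.Perm (Fin (p + q)), outerProd h h' (i ∘ σ) := rfl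

lemma toPoly_symProd {p q m : ℕ} (e : p + q = m) (h : Tensor ι p) (h' : Tensor ι q)
    (c : ι → K) : toPoly (symProd e h h') c = toPoly h c * toPoly h' c := by
  subst e
  rw [symProd_rfl, toPoly_symmetrization, toPoly_outerProd]

lemma symmetrization_isSymmetric {ι : Type*} {m : ℕ} (h : Tensor ι m) (r : ℝ) :
    IsSymmetric (fun i => r * ∑ σ : Equiv.Perm (Fin m), h (i ∘ σ)) := by
  intro τ i
  simp only [Function.comp_assoc]
  congr 1
  exact Fintype.sum_equiv (Equiv.mulLeft τ) _ _ fun σ => rfl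

lemma isSymmetric_symProd {ι : Type*} {p q m : ℕ} (e : p + q = m) (h : Tensor ι p) (h' : Tensor ι q) :
    IsSymmetric (symProd e h h') := by
  subst e
  exact symmetrization_isSymmetric (outerProd h h') _

/-- Equal exponents mean that the fibres of `i` and `j` over each index have the same size;
bijections between the fibres glue to a permutation. -/
lemma exists_perm_of_sum_single_eq {ι : Type*} {m : ℕ} {i j : Fin m → ι}
    (hij : ∑ s, Finsupp.single (i s) 1 = ∑ s, Finsupp.single (j s) 1) :
    ∃ σ : Equiv.Perm (Fin m), i = j ∘ σ := by
  classical
  have hc : ∀ a, Nonempty ({s // i s = a} ≃ {s // j s = a}) := by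
    intro a
    refine Fintype.card_eq.mp ?_
    have := DFunLike.congr_fun hij a
    simpa [Finsupp.finsetSum_apply, Finsupp.single_apply, Fintype.card_subtype] using this
  refine ⟨Equiv.ofFiberEquiv fun a => (hc a).some, ?_⟩
  funext s
  exact (Equiv.ofFiberEquiv_map _ s).symm

/-- A symmetric tensor with vanishing polynomial function is zero. -/
lemma IsSymmetric.eq_zero {m : ℕ} {h : Tensor ι m} (hs : IsSymmetric h)
    (h0 : ∀ c : ι → ℝ, toPoly h c = 0) : h = 0 := by
  classical
  have hP : (∑ i : Fin m → ι, MvPolynomial.C (h i) * ∏ s, MvPolynomial.X (i s) :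
      MvPolynomial ι ℝ) = 0 := by
    refine MvPolynomial.funext fun c => ?_
    simpa [toPoly] using h0 c
  have hmon : ∀ i : Fin m → ι, (MvPolynomial.C (h i) * ∏ s, MvPolynomial.X (i s) :
      MvPolynomial ι ℝ) = MvPolynomial.monomial (∑ s, Finsupp.single (i s) 1) (h i) := by
    intro i
    rw [MvPolynomial.monomial_sum_index]
    rfl
  funext i
  have := congrArg (MvPolynomial.coeff (∑ s, Finsupp.single (i s) 1)) hP
  simp only [hmon, MvPolynomial.coeff_sum, MvPolynomial.coeff_monomial,
    MvPolynomial.coeff_zero] at this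
  -- Tuples with the same monomial as `i` are rearrangements of `i`, where `h` takes the value `h
  -- i`. The coefficient is therefore a positive multiple of `h i`.
  rw [← Finset.sum_filter, Finset.sum_congr rfl (g := fun _ => h i) fun j hj => ?_,
    Finset.sum_const, nsmul_eq_mul] at this
  · refine (mul_eq_zero.mp this).resolve_left ?_
    refine Nat.cast_ne_zero.mpr ?_
    exact Finset.card_ne_zero_of_mem (a := i) (by simp)
  · obtain ⟨σ, rfl⟩ := exists_perm_of_sum_single_eq (Finset.mem_filter.mp hj).2
    exact hs σ i

lemma IsSymmetric.ext {m : ℕ} {h h' : Tensor ι m} (hs : IsSymmetric h) (hs' : IsSymmetric h')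
    (h0 : ∀ c : ι → ℝ, toPoly h c = toPoly h' c) : h = h' := by
  have hd : IsSymmetric (h + (-1 : ℝ) • h') := fun σ i => by
    simp [hs σ i, hs' σ i]
  have := hd.eq_zero fun c => by rw [toPoly_add, toPoly_smul, h0 c]; simp
  funext i
  have := congrFun this i
  simp at this
  linarith

end TensorAlgebra

/-! ### Invariance of tensors and the infinitesimal action. -/

section Invariance

variable {ι : Type*} [Fintype ι] {𝔤 : Type*} [LieRing 𝔤] [LieAlgebra ℝ 𝔤]
  (X : Module.Basis ι ℝ 𝔤)

variable {X} in
lemma IsInvariant.comp_perm {m : ℕ} {h : Tensor ι m} (hh : IsInvariant X h)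
    (σ : Equiv.Perm (Fin m)) : IsInvariant X (fun i => h (i ∘ σ)) := by
  intro ν i
  rw [← hh ν (i ∘ σ), ← Equiv.sum_comp σ]
  refine Finset.sum_congr rfl fun s _ => Finset.sum_congr rfl fun ρ _ => ?_
  rw [← Function.update_comp_eq_of_injective i σ.injective]
  rfl

variable {X} in
lemma IsInvariant.sum {m : ℕ} {κ : Type*} (t : Finset κ) {h : κ → Tensor ι m}
    (hh : ∀ k ∈ t, IsInvariant X (h k)) : IsInvariant X (fun i => ∑ k ∈ t, h k i) := by
  intro ν i
  simp only [Finset.mul_sum]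
  rw [Finset.sum_congr rfl fun s _ => Finset.sum_comm, Finset.sum_comm]
  exact Finset.sum_eq_zero fun k hk => hh k hk ν i

variable {X} in
lemma IsInvariant.const_mul {m : ℕ} (r : ℝ) {h : Tensor ι m}
    (hh : IsInvariant X h) : IsInvariant X (fun i => r * h i) := by
  intro ν i
  have := congrArg (r * ·) (hh ν i)
  simp only [Finset.mul_sum, mul_zero] at this
  rw [← this]
  exact Finset.sum_congr rfl fun s _ => Finset.sum_congr rfl fun ρ _ => by ring

variable {X} in
lemma IsInvariant.add {m : ℕ} {h h' : Tensor ι m}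
    (hh : IsInvariant X h) (hh' : IsInvariant X h') : IsInvariant X (h + h') := by
  intro ν i
  have := congrArg₂ (· + ·) (hh ν i) (hh' ν i)
  simp only [← Finset.sum_add_distrib, ← mul_add, add_zero] at this
  exact this

variable {X} in
lemma IsInvariant.outer {p q : ℕ} {h : Tensor ι p} {h' : Tensor ι q}
    (hh : IsInvariant X h) (hh' : IsInvariant X h') :
    IsInvariant X (outerProd h h') := by
  intro ν i
  have e1 : ∀ (a : Fin p) (ρ : ι),
      (fun s => Function.update i (Fin.castAdd q a) ρ (Fin.castAdd q s)) =
        Function.update (fun s => i (Fin.castAdd q s)) a ρ := fun a ρ =>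
    Function.update_comp_eq_of_injective i (Fin.castAdd_injective p q) a ρ
  have e2 : ∀ (a : Fin p) (ρ : ι),
      (fun s => Function.update i (Fin.castAdd q a) ρ (Fin.natAdd p s)) =
        fun s => i (Fin.natAdd p s) := fun a ρ => by
    funext s
    refine Function.update_of_ne (fun hc => ?_) _ _
    have := congrArg Fin.val hc
    simp at this
    omega
  have e3 : ∀ (a : Fin q) (ρ : ι),
      (fun s => Function.update i (Fin.natAdd p a) ρ (Fin.natAdd p s)) =
        Function.update (fun s => i (Fin.natAdd p s)) a ρ := fun a ρ =>
    Function.update_comp_eq_of_injective i (Fin.natAdd_injective q p) a ρ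
  have e4 : ∀ (a : Fin q) (ρ : ι),
      (fun s => Function.update i (Fin.natAdd p a) ρ (Fin.castAdd q s)) =
        fun s => i (Fin.castAdd q s) := fun a ρ => by
    funext s
    refine Function.update_of_ne (fun hc => ?_) _ _
    have := congrArg Fin.val hc
    simp at this
    omega
  rw [Fin.sum_univ_add]
  simp only [outerProd, e1, e2, e3, e4]
  have h1 := congrArg (· * h' (fun s => i (Fin.natAdd p s))) (hh ν fun s => i (Fin.castAdd q s))
  have h2 := congrArg (h (fun s => i (Fin.castAdd q s)) * ·) (hh' ν fun s => i (Fin.natAdd p s))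
  simp only [Finset.sum_mul, zero_mul] at h1
  simp only [Finset.mul_sum, mul_zero] at h2
  convert congrArg₂ (· + ·) h1 h2 using 1
  · congr 1
    · exact Finset.sum_congr rfl fun s _ => Finset.sum_congr rfl fun ρ _ => by ring
    · exact Finset.sum_congr rfl fun s _ => Finset.sum_congr rfl fun ρ _ => by ring
  · simp

variable {X} in
lemma IsInvariant.symProd {p q m : ℕ} (e : p + q = m) {h : Tensor ι p} {h' : Tensor ι q}
    (hh : IsInvariant X h) (hh' : IsInvariant X h') : IsInvariant X (symProd e h h') := by
  subst e
  exact (IsInvariant.sum _ fun σ _ => (hh.outer hh').comp_perm σ).const_mul _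

/-- The action of a Lie algebra element on vectors with coordinates in `ℂ`. -/
def adCoord (B : 𝔤) (c : ι → ℂ) : ι → ℂ :=
  fun ρ => ∑ j, c j * (X.repr ⁅B, X j⁆ ρ : ℂ)

/-- Coordinates of a Lie algebra element, as complex numbers. -/
def coordC (M : 𝔤) : ι → ℂ := fun i => (X.repr M i : ℂ)

lemma repr_bracket (B : 𝔤) (j ρ : ι) :
    X.repr ⁅B, X j⁆ ρ = ∑ ν, X.repr B ν * structureConst X ν j ρ := by
  conv_lhs => rw [← X.sum_repr B]
  rw [sum_lie, map_sum, Finsupp.finsetSum_apply]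
  simp [structureConst]

lemma adCoord_coordC (B M : 𝔤) : adCoord X B (coordC X M) = coordC X ⁅B, M⁆ := by
  funext ρ
  simp only [adCoord, coordC]
  conv_rhs => rw [← X.sum_repr M]
  rw [lie_sum, map_sum, Finsupp.finsetSum_apply]
  simp

lemma adCoord_add (B : 𝔤) (c d : ι → ℂ) :
    adCoord X B (c + d) = adCoord X B c + adCoord X B d := by
  funext ρ
  simp [adCoord, add_mul, Finset.sum_add_distrib]

lemma adCoord_smul (B : 𝔤) (z : ℂ) (c : ι → ℂ) :
    adCoord X B (z • c) = z • adCoord X B c := by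
  funext ρ
  simp [adCoord, mul_assoc, Finset.mul_sum]

variable {X} in
-- The sum is the derivative of the polynomial of `h` in the direction `adCoord X B c`. Invariance
-- in real coordinates suffices for complex `c`, since the condition is linear in the coefficients
-- of `h`.
lemma IsInvariant.sum_adCoord {m : ℕ} {h : Tensor ι m} (hh : IsInvariant X h) (B : 𝔤)
    (c : ι → ℂ) :
    ∑ i, (h i : ℂ) * ∑ s, (∏ r ∈ Finset.univ.erase s, c (i r)) * adCoord X B c (i s) = 0 := by
  have key : ∀ s : Fin m,
      ∑ i, (h i : ℂ) * ((∏ r ∈ Finset.univ.erase s, c (i r)) * adCoord X B c (i s)) =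
      ∑ i, ∑ ρ, (h (Function.update i s ρ) : ℂ) * (X.repr ⁅B, X (i s)⁆ ρ : ℂ) * ∏ r, c (i r) := by
    intro s
    simp only [adCoord, Finset.mul_sum]
    rw [← Fintype.sum_prod_type', ← Fintype.sum_prod_type']
    -- Exchanging the index at position `s` with the summed index `ρ` moves the action from the
    -- vector to the tensor.
    have hinv : Function.Involutive
        fun x : (Fin m → ι) × ι => (Function.update x.1 s x.2, x.1 s) := by
      intro x
      simp
    refine Fintype.sum_equiv hinv.toPerm _ _ fun x => ?_
    obtain ⟨i, ρ⟩ := x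
    simp only [Function.Involutive.coe_toPerm, Function.update_idem, Function.update_self,
      Function.update_eq_self]
    rw [← Finset.mul_prod_erase Finset.univ _ (Finset.mem_univ s), Function.update_self]
    have : ∀ r ∈ Finset.univ.erase s, c (Function.update i s ρ r) = c (i r) := fun r hr => by
      rw [Function.update_of_ne (Finset.ne_of_mem_erase hr)]
    rw [Finset.prod_congr rfl this]
    ring
  simp only [Finset.mul_sum]
  rw [Finset.sum_comm]
  simp only [key]
  rw [Finset.sum_comm]
  refine Finset.sum_eq_zero fun i _ => ?_
  have h0 : ∑ ν, X.repr B ν * ∑ s, ∑ ρ, structureConst X ν (i s) ρ *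
      h (Function.update i s ρ) = 0 := Finset.sum_eq_zero fun ν _ => by rw [hh ν i, mul_zero]
  have h1 : ∑ s, ∑ ρ, h (Function.update i s ρ) * X.repr ⁅B, X (i s)⁆ ρ = 0 := by
    rw [← h0]
    simp only [repr_bracket, Finset.mul_sum]
    rw [Finset.sum_congr rfl fun s _ => Finset.sum_comm, Finset.sum_comm]
    exact Finset.sum_congr rfl fun s _ => Finset.sum_congr rfl fun ρ _ =>
      Finset.sum_congr rfl fun ν _ => by ring
  simp only [← Finset.sum_mul]
  have h2 := congrArg (fun x : ℝ => (x : ℂ)) h1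
  push_cast at h2
  rw [h2, zero_mul]

end Invariance

/-! ### The symmetric traces. -/

section Trace

/-- The commutator with `B` is a derivation, so this is the Leibniz rule for a product of `m`
factors. -/
lemma sum_prod_update_commutator {R : Type*} [Ring R] (B : R) :
    ∀ (m : ℕ) (v : Fin m → R),
      ∑ s, (List.ofFn (Function.update v s (B * v s - v s * B))).prod =
        B * (List.ofFn v).prod - (List.ofFn v).prod * B := by
  intro m
  induction m with
  | zero => intro v; simp
  | succ m ih =>
    intro v
    have h0 : ∀ x, (List.ofFn (Function.update v 0 x)).prod =
        x * (List.ofFn fun s : Fin m => v s.succ).prod := by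
      intro x
      rw [List.ofFn_succ, List.prod_cons, Function.update_self]
      congr 3
    have h1 : ∀ (s : Fin m) x, (List.ofFn (Function.update v s.succ x)).prod =
        v 0 * (List.ofFn (Function.update (fun r : Fin m => v r.succ) s x)).prod := by
      intro s x
      rw [List.ofFn_succ, List.prod_cons, Function.update_of_ne (Fin.succ_ne_zero s).symm]
      congr 3
      exact Function.update_comp_eq_of_injective v (Fin.succ_injective m) s x
    rw [Fin.sum_univ_succ, h0, List.ofFn_succ, List.prod_cons]
    simp only [h1]
    rw [← Finset.mul_sum, ih fun r => v r.succ]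
    noncomm_ring

variable {ι : Type*} {l : ℕ} (X : Module.Basis ι ℝ (D l))

lemma transpose_coe (A : D l) : (A : Matrix (Fin (2 * l)) (Fin (2 * l)) ℝ).transpose =
    -(A : Matrix (Fin (2 * l)) (Fin (2 * l)) ℝ) :=
  (LieAlgebra.Orthogonal.mem_so _ _ _).mp A.2

/-- The tensor of a multilinear form on matrices is invariant if the form is annihilated by the
commutators with skew-symmetric matrices. -/
lemma isInvariant_of_multilinear [Fintype ι] {m : ℕ}
    (T : MultilinearMap ℝ (fun _ : Fin m => Matrix (Fin (2 * l)) (Fin (2 * l)) ℝ) ℝ)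
    (hT : ∀ B : Matrix (Fin (2 * l)) (Fin (2 * l)) ℝ, B.transpose = -B →
      ∀ v : Fin m → Matrix (Fin (2 * l)) (Fin (2 * l)) ℝ,
        ∑ s, T (Function.update v s (B * v s - v s * B)) = 0) :
    IsInvariant X (fun i => T fun s => (X (i s) : Matrix (Fin (2 * l)) (Fin (2 * l)) ℝ)) := by
  intro ν i
  rw [← hT (X ν) (transpose_coe _) fun s => X (i s)]
  refine Finset.sum_congr rfl fun s _ => ?_
  have hb : (X ν : Matrix (Fin (2 * l)) (Fin (2 * l)) ℝ) * X (i s) - X (i s) * X ν =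
      ∑ ρ, structureConst X ν (i s) ρ • (X ρ : Matrix (Fin (2 * l)) (Fin (2 * l)) ℝ) := by
    have := congrArg (fun A : D l => (A : Matrix (Fin (2 * l)) (Fin (2 * l)) ℝ))
      (X.sum_repr ⁅X ν, X (i s)⁆)
    simp only [AddSubmonoidClass.coe_finsetSum, LieSubalgebra.coe_bracket,
      LieRing.of_associative_ring_bracket] at this
    exact this.symm
  rw [hb, T.map_update_sum]
  refine Finset.sum_congr rfl fun ρ _ => ?_
  rw [T.map_update_smul, smul_eq_mul]
  congr 1
  refine congrArg T ?_
  funext r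
  by_cases hr : r = s
  · subst hr; simp
  · simp [hr]

/-- The trace of a product of matrices. -/
def traceProd (K : Type*) [CommRing K] (n : Type*) [Fintype n] [DecidableEq n] (m : ℕ) :
    MultilinearMap K (fun _ : Fin m => Matrix n n K) K :=
  (Matrix.traceLinearMap n K K).compMultilinearMap (MultilinearMap.mkPiAlgebraFin K m _)

lemma traceProd_apply {K : Type*} [CommRing K] {n : Type*} [Fintype n] [DecidableEq n] {m : ℕ}
    (v : Fin m → Matrix n n K) : traceProd K n m v = (List.ofFn v).prod.trace := by
  simp [traceProd]

/-- The tensor `Tr (X_{i_1} … X_{i_m})`. -/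
def traceTensor (m : ℕ) : Tensor ι m :=
  fun j => traceProd ℝ (Fin (2 * l)) m fun s => (X (j s) : Matrix (Fin (2 * l)) (Fin (2 * l)) ℝ)

lemma symTrace_eq (m : ℕ) : symTrace X m = fun i => (1 / (m.factorial : ℝ)) *
    ∑ σ : Equiv.Perm (Fin m), traceTensor X m (i ∘ σ) := by
  funext i
  simp only [traceTensor, traceProd_apply]
  rfl

lemma isSymmetric_symTrace (m : ℕ) : IsSymmetric (symTrace X m) := by
  rw [symTrace_eq]
  exact symmetrization_isSymmetric _ _

lemma isInvariant_symTrace [Fintype ι] (m : ℕ) : IsInvariant X (symTrace X m) := by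
  rw [symTrace_eq]
  refine (IsInvariant.sum _ fun σ _ => IsInvariant.comp_perm
    (isInvariant_of_multilinear X _ fun B _ v => ?_) σ).const_mul _
  simp only [traceProd_apply]
  rw [← Matrix.trace_sum, sum_prod_update_commutator, Matrix.trace_sub, Matrix.trace_mul_comm,
    sub_self]

/-- The matrix `λ^i X_i` for coordinates in an extension of `ℝ`. -/
def comboIn {K : Type*} [CommRing K] [Algebra ℝ K] [Fintype ι] (c : ι → K) :
    Matrix (Fin (2 * l)) (Fin (2 * l)) K :=
  ∑ i, c i • (X i : Matrix (Fin (2 * l)) (Fin (2 * l)) ℝ).map (algebraMap ℝ K)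

lemma comboIn_real [Fintype ι] (c : ι → ℝ) : comboIn X c = combo X c := by
  simp [comboIn, combo]

/-- General coefficients are needed: ℝ for the identities, ℂ for evaluation on the Cartan
subalgebra. -/
lemma toPoly_symTrace {K : Type*} [CommRing K] [Algebra ℝ K] [Fintype ι] (m : ℕ) (c : ι → K) :
    toPoly (symTrace X m) c = (comboIn X c ^ m).trace := by
  rw [symTrace_eq, toPoly_symmetrization]
  have hp : comboIn X c ^ m = (List.ofFn fun _ : Fin m => comboIn X c).prod := by simp
  rw [hp, ← traceProd_apply]
  simp only [comboIn, toPoly, traceTensor]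
  rw [MultilinearMap.map_sum]
  refine Finset.sum_congr rfl fun i _ => ?_
  rw [MultilinearMap.map_smul_univ, smul_eq_mul, mul_comm]
  congr 1
  rw [traceProd_apply, traceProd_apply]
  have := map_list_prod (RingHom.mapMatrix (algebraMap ℝ K) : Matrix (Fin (2 * l)) (Fin (2 * l)) ℝ →+* _)
    (List.ofFn fun s => (X (i s) : Matrix (Fin (2 * l)) (Fin (2 * l)) ℝ))
  rw [List.map_ofFn] at this
  refine (AddMonoidHom.map_trace (algebraMap ℝ K).toAddMonoidHom _).trans ?_
  exact congrArg Matrix.trace this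

lemma combo_transpose [Fintype ι] (c : ι → ℝ) : (combo X c).transpose = -combo X c := by
  simp only [combo, Matrix.transpose_sum, Matrix.transpose_smul, transpose_coe, smul_neg,
    Finset.sum_neg_distrib]

lemma symTrace_odd [Fintype ι] {m : ℕ} (hm : Odd m) : symTrace X m = 0 := by
  refine (isSymmetric_symTrace X m).eq_zero fun c => ?_
  rw [toPoly_symTrace, comboIn_real]
  have := Matrix.trace_transpose (combo X c ^ m)
  rw [Matrix.transpose_pow, combo_transpose, hm.neg_pow, Matrix.trace_neg] at this
  linarith

end Trace

/-! ### Newton's identities for skew-symmetric matrices. -/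

section Newton

open Finset in
/-- Newton's identities for the traces of the powers of a skew-symmetric matrix. -/
lemma exists_newton {n : ℕ} (A : Matrix (Fin n) (Fin n) ℝ) (hA : A.transpose = -A) :
    ∃ E : ℕ → ℝ, E n = A.det ∧ (∀ k, n < k → E k = 0) ∧
      ∀ k, 0 < k → (A ^ k).trace = (-1) ^ (k + 1) * k * E k -
        ∑ a ∈ antidiagonal k with a.1 ∈ Set.Ioo 0 k, (-1) ^ a.1 * E a.1 * (A ^ a.2).trace := by
  set M : Matrix (Fin n) (Fin n) ℂ := A.map Complex.ofRealHom with hM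
  have hH : (Complex.I • M).IsHermitian := by
    ext i j
    have := congrFun (congrFun hA i) j
    simp only [Matrix.transpose_apply, Matrix.neg_apply] at this
    simp [hM, this]
  set μ : Fin n → ℂ := fun i => -Complex.I * (hH.eigenvalues i : ℂ) with hμ
  obtain ⟨U, hU⟩ : ∃ U : Matrix.unitaryGroup (Fin n) ℂ,
      M = (U : Matrix (Fin n) (Fin n) ℂ) * Matrix.diagonal μ * star (U : Matrix _ _ ℂ) := by
    refine ⟨hH.eigenvectorUnitary, ?_⟩
    have h1 := hH.spectral_theorem
    rw [Unitary.conjStarAlgAut_apply] at h1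
    have h2 : M = -Complex.I • (Complex.I • M) := by simp [smul_smul]
    have h3 : Matrix.diagonal μ = -Complex.I • Matrix.diagonal
        (RCLike.ofReal ∘ hH.eigenvalues : Fin n → ℂ) := by
      rw [← Matrix.diagonal_smul]
      rfl
    rw [h3, Matrix.mul_smul, Matrix.smul_mul, ← h1, ← h2]
  have hUU : star (U : Matrix (Fin n) (Fin n) ℂ) * (U : Matrix (Fin n) (Fin n) ℂ) = 1 :=
    Unitary.coe_star_mul_self U
  have hpow : ∀ k, M ^ k = (U : Matrix (Fin n) (Fin n) ℂ) * Matrix.diagonal μ ^ k *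
      star (U : Matrix _ _ ℂ) := by
    intro k
    induction k with
    | zero => simp
    | succ k ih =>
      rw [pow_succ, ih, hU, pow_succ]
      simp only [Matrix.mul_assoc]
      rw [← Matrix.mul_assoc (star _) (U : Matrix (Fin n) (Fin n) ℂ), hUU, Matrix.one_mul]
  have htr : ∀ k, (((A ^ k).trace : ℝ) : ℂ) = ∑ i, μ i ^ k := by
    intro k
    have h1 : (((A ^ k).trace : ℝ) : ℂ) = (M ^ k).trace := by
      rw [hM, ← RingHom.mapMatrix_apply, ← map_pow]
      exact AddMonoidHom.map_trace Complex.ofRealHom.toAddMonoidHom _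
    rw [h1, hpow, Matrix.trace_mul_comm, ← Matrix.mul_assoc, hUU, Matrix.one_mul,
      Matrix.diagonal_pow, Matrix.trace_diagonal]
    rfl
  have hdet : ((A.det : ℝ) : ℂ) = ∏ i, μ i := by
    have h1 : ((A.det : ℝ) : ℂ) = M.det := RingHom.map_det Complex.ofRealHom A
    rw [h1, hU, Matrix.det_mul_comm, ← Matrix.mul_assoc, hUU, Matrix.one_mul,
      Matrix.det_diagonal]
  -- Real parts suffice: the traces are real and the numerical coefficients in Newton's identities
  -- are real, so taking the real part of each identity keeps its form.
  refine ⟨fun k => (MvPolynomial.aeval μ (MvPolynomial.esymm (Fin n) ℂ k)).re, ?_, ?_, ?_⟩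
  · beta_reduce
    have hu : powersetCard n (univ : Finset (Fin n)) = {univ} := by
      have := powersetCard_self (univ : Finset (Fin n))
      rwa [card_univ, Fintype.card_fin] at this
    rw [MvPolynomial.esymm.eq_1, hu, sum_singleton, map_prod]
    simp only [MvPolynomial.aeval_X]
    rw [← hdet, Complex.ofReal_re]
  · intro k hk
    beta_reduce
    rw [MvPolynomial.esymm.eq_1, powersetCard_eq_empty.mpr (by simpa using hk)]
    simp
  · intro k hk
    have h := congrArg (MvPolynomial.aeval μ) (MvPolynomial.psum_eq_mul_esymm_sub_sum (Fin n) ℂ k hk)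
    simp only [map_sub, map_mul, map_sum, map_pow, map_neg, map_one, map_natCast] at h
    have hps : ∀ k, MvPolynomial.aeval μ (MvPolynomial.psum (Fin n) ℂ k) =
        (((A ^ k).trace : ℝ) : ℂ) := by
      intro k
      rw [htr]
      simp [MvPolynomial.psum]
    simp only [hps] at h
    have h' := congrArg Complex.re h
    rw [Complex.ofReal_re, Complex.sub_re, Complex.re_sum] at h'
    rw [h']
    congr 1
    · rw [← Complex.re_ofReal_mul]
      push_cast
      rfl
    · refine sum_congr rfl fun a _ => ?_
      rw [Complex.re_mul_ofReal, ← Complex.re_ofReal_mul]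
      push_cast
      rfl

end Newton

/-! ### The polarised Pfaffian and its invariance. -/

section Pfaffian

/-- The pairing `(s, 0) ↦ 2s`, `(s, 1) ↦ 2s + 1` of `2l` indices. -/
def pairEquiv (l : ℕ) : Fin l × Fin 2 ≃ Fin (2 * l) :=
  finProdFinEquiv.trans (finCongr (mul_comm l 2))

lemma pairEquiv_zero {l : ℕ} (s : Fin l) : pairEquiv l (s, 0) = ⟨2 * s.val, by omega⟩ := by
  ext; simp [pairEquiv]

lemma pairEquiv_one {l : ℕ} (s : Fin l) : pairEquiv l (s, 1) = ⟨2 * s.val + 1, by omega⟩ := by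
  ext; simp [pairEquiv]; omega

variable {κ n : Type*} [Fintype κ] [Fintype n] [DecidableEq n]

/-- The polarised Pfaffian, without its normalising factor. -/
def pfForm (e : κ × Fin 2 ≃ n) : MultilinearMap ℝ (fun _ : κ => Matrix n n ℝ) ℝ :=
  ∑ σ : Equiv.Perm n, ((Equiv.Perm.sign σ : ℤ) : ℝ) •
    (MultilinearMap.mkPiAlgebra ℝ κ ℝ).compLinearMap fun s =>
      Matrix.entryLinearMap ℝ ℝ (σ (e (s, 0))) (σ (e (s, 1)))

lemma pfForm_apply (e : κ × Fin 2 ≃ n) (v : κ → Matrix n n ℝ) :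
    pfForm e v = ∑ σ : Equiv.Perm n, ((Equiv.Perm.sign σ : ℤ) : ℝ) *
      ∏ s, v s (σ (e (s, 0))) (σ (e (s, 1))) := by
  simp [pfForm]

/-- Permuting the pairs by `π` acts once on first members and once on second members, so its sign is
sign(π)² = 1 and it can be absorbed into `σ`. -/
lemma pfForm_comp_perm [DecidableEq κ] (e : κ × Fin 2 ≃ n) (v : κ → Matrix n n ℝ) (π : Equiv.Perm κ) :
    pfForm e (v ∘ π) = pfForm e v := by
  rw [pfForm_apply, pfForm_apply]
  set P : Equiv.Perm n := e.permCongr (Equiv.prodCongrLeft fun _ : Fin 2 => π) with hP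
  have hs : Equiv.Perm.sign P = 1 := by
    rw [hP, Equiv.Perm.sign_permCongr, Equiv.Perm.sign_prodCongrLeft]
    simp
  have hPe : ∀ s ε, P (e (s, ε)) = e (π s, ε) := by
    intro s ε
    simp [hP, Equiv.permCongr_apply]
  symm
  refine Fintype.sum_equiv (Equiv.mulRight P) _ _ fun σ => ?_
  simp only [Equiv.coe_mulRight, Equiv.Perm.sign_mul, hs, mul_one, Equiv.Perm.mul_apply, hPe,
    Function.comp_apply]
  rw [Equiv.prod_comp π fun s => v s (σ (e (s, 0))) (σ (e (s, 1)))]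

/-- Expanding each difference chooses whether to swap the two indices of each pair. The sign of a
swap is cancelled by that of the reindexed `σ`, so all 2^|κ| choices contribute equally. -/
lemma pfForm_sub_transpose [DecidableEq κ] (e : κ × Fin 2 ≃ n) (a : κ → Matrix n n ℝ) :
    pfForm e (fun s => a s - (a s).transpose) = 2 ^ Fintype.card κ * pfForm e a := by
  have hu : (Finset.univ : Finset (Equiv.Perm (Fin 2))) = {1, Equiv.swap 0 1} := by decide
  have h2 : ∀ (x : n → n → ℝ) (p : Fin 2 → n), x (p 0) (p 1) - x (p 1) (p 0) =
      ∑ τ : Equiv.Perm (Fin 2), ((Equiv.Perm.sign τ : ℤ) : ℝ) * x (p (τ 0)) (p (τ 1)) := by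
    intro x p
    rw [hu, Finset.sum_pair (by decide)]
    simp [sub_eq_add_neg]
  have h3 : ∀ τ : κ → Equiv.Perm (Fin 2), ∑ σ : Equiv.Perm n, ((Equiv.Perm.sign σ : ℤ) : ℝ) *
      ∏ s, (((Equiv.Perm.sign (τ s) : ℤ) : ℝ) * a s (σ (e (s, τ s 0))) (σ (e (s, τ s 1)))) =
      pfForm e a := by
    intro τ
    set Q : Equiv.Perm n := e.permCongr (Equiv.prodCongrRight τ) with hQ
    have hQe : ∀ s ε, Q (e (s, ε)) = e (s, τ s ε) := by
      intro s ε
      simp [hQ, Equiv.permCongr_apply]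
    rw [pfForm_apply]
    refine Fintype.sum_equiv (Equiv.mulRight Q) _ _ fun σ => ?_
    simp only [Equiv.coe_mulRight, Equiv.Perm.sign_mul, Equiv.Perm.mul_apply, hQe]
    rw [hQ, Equiv.Perm.sign_permCongr, Equiv.Perm.sign_prodCongrRight, Finset.prod_mul_distrib]
    push_cast
    ring
  rw [pfForm_apply]
  have h4 : ∀ σ : Equiv.Perm n,
      ∏ s, (a s - (a s).transpose) (σ (e (s, 0))) (σ (e (s, 1))) =
      ∑ τ : κ → Equiv.Perm (Fin 2),
        ∏ s, (((Equiv.Perm.sign (τ s) : ℤ) : ℝ) * a s (σ (e (s, τ s 0))) (σ (e (s, τ s 1)))) := by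
    intro σ
    have := Finset.prod_univ_sum (fun _ : κ => (Finset.univ : Finset (Equiv.Perm (Fin 2))))
      fun s τ => ((Equiv.Perm.sign τ : ℤ) : ℝ) * a s (σ (e (s, τ 0))) (σ (e (s, τ 1)))
    rw [Fintype.piFinset_univ] at this
    rw [← this]
    exact Finset.prod_congr rfl fun s _ => h2 (a s) fun ε => σ (e (s, ε))
  simp only [h4, Finset.mul_sum]
  rw [Finset.sum_comm]
  simp only [h3]
  simp [Fintype.card_perm]

/-- The alternating sum behind the invariance of the Pfaffian and the determinant: replacing one
value of a permutation through a matrix with zero diagonal. -/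
lemma sum_sign_update_eq_zero (B : Matrix n n ℝ) (hB : ∀ i, B i i = 0) (G : (n → n) → ℝ) :
    ∑ σ : Equiv.Perm n, ((Equiv.Perm.sign σ : ℤ) : ℝ) *
      ∑ r, ∑ c, B (σ r) c * G (Function.update σ r c) = 0 := by
  have h1 : ∀ σ : Equiv.Perm n, ∑ r, ∑ c, B (σ r) c * G (Function.update σ r c) =
      ∑ x ∈ Finset.univ.offDiag, B (σ x.1) (σ x.2) * G (Function.update σ x.1 (σ x.2)) := by
    intro σ
    rw [Finset.sum_subset (Finset.subset_univ Finset.univ.offDiag)]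
    · rw [Fintype.sum_prod_type]
      exact Finset.sum_congr rfl fun r _ => (Equiv.sum_comp σ
        fun c => B (σ r) c * G (Function.update σ r c)).symm
    · intro x _ hx
      have : x.1 = x.2 := by simpa using hx
      rw [this, hB, zero_mul]
  simp only [h1, Finset.mul_sum]
  rw [Finset.sum_comm]
  -- Exchange `r` and `r'` and compose `σ` with their transposition: the entry of `B` and the
  -- updated map are unchanged, while the sign flips.
  have hswap : ∑ x ∈ (Finset.univ : Finset n).offDiag, ∑ σ : Equiv.Perm n,
      ((Equiv.Perm.sign σ : ℤ) : ℝ) * (B (σ x.1) (σ x.2) * G (Function.update σ x.1 (σ x.2))) =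
      -∑ x ∈ (Finset.univ : Finset n).offDiag, ∑ σ : Equiv.Perm n,
      ((Equiv.Perm.sign σ : ℤ) : ℝ) * (B (σ x.1) (σ x.2) * G (Function.update σ x.1 (σ x.2))) := by
    conv_rhs => rw [← Finset.sum_neg_distrib]
    refine Finset.sum_nbij' Prod.swap Prod.swap ?_ ?_ ?_ ?_ ?_
    · intro x hx; simpa [eq_comm] using hx
    · intro x hx; simpa [eq_comm] using hx
    · simp
    · simp
    · rintro ⟨r, r'⟩ hx
      have hne : r ≠ r' := by simpa using hx
      rw [← Finset.sum_neg_distrib]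
      refine Fintype.sum_equiv (Equiv.mulRight (Equiv.swap r r')) _ _ fun σ => ?_
      have hu : Function.update (⇑(σ * Equiv.swap r r')) r' (σ r') = Function.update σ r (σ r') := by
        funext t
        by_cases h1 : t = r'
        · subst h1; simp [hne.symm]
        · by_cases h2 : t = r
          · subst h2; simp [hne]
          · simp [h1, h2, Equiv.swap_apply_of_ne_of_ne h2 h1]
      simp only [Equiv.coe_mulRight, Prod.fst_swap, Prod.snd_swap, Equiv.Perm.mul_apply,
        Equiv.swap_apply_left, Equiv.swap_apply_right, Equiv.Perm.sign_mul,
        Equiv.Perm.sign_swap hne]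
      rw [hu]
      push_cast
      ring
  linarith

/-- As `B` is skew, the commutator acts on the row and the column index of each factor by the same
rule. Summed over the factors, it replaces one value of `σ` at every position, which is the
alternating sum of `sum_sign_update_eq_zero`. -/
lemma sum_pfForm_commutator [DecidableEq κ] (e : κ × Fin 2 ≃ n) (B : Matrix n n ℝ) (hB : B.transpose = -B)
    (v : κ → Matrix n n ℝ) :
    ∑ s, pfForm e (Function.update v s (B * v s - v s * B)) = 0 := by
  have hBe : ∀ i j, B j i = -B i j := fun i j => congrFun (congrFun hB i) j
  rw [← sum_sign_update_eq_zero B (fun i => by linarith [hBe i i])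
    fun f => ∏ s, v s (f (e (s, 0))) (f (e (s, 1)))]
  simp only [pfForm_apply]
  rw [Finset.sum_comm]
  refine Finset.sum_congr rfl fun σ _ => ?_
  rw [← Finset.mul_sum]
  congr 1
  rw [← Equiv.sum_comp e, Fintype.sum_prod_type]
  refine Finset.sum_congr rfl fun s _ => ?_
  rw [Fin.sum_univ_two, ← Finset.sum_add_distrib]
  have hf : ∀ (ε : Fin 2) (c : n), ∏ s' ∈ Finset.univ.erase s,
      v s' (Function.update σ (e (s, ε)) c (e (s', 0))) (Function.update σ (e (s, ε)) c (e (s', 1))) =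
      ∏ s' ∈ Finset.univ.erase s, v s' (σ (e (s', 0))) (σ (e (s', 1))) := by
    intro ε c
    refine Finset.prod_congr rfl fun s' hs' => ?_
    have hne := Finset.ne_of_mem_erase hs'
    rw [Function.update_of_ne (by simp [hne]), Function.update_of_ne (by simp [hne])]
  have hl : ∏ s' ∈ Finset.univ.erase s, Function.update v s (B * v s - v s * B) s'
      (σ (e (s', 0))) (σ (e (s', 1))) =
      ∏ s' ∈ Finset.univ.erase s, v s' (σ (e (s', 0))) (σ (e (s', 1))) :=
    Finset.prod_congr rfl fun s' hs' => by rw [Function.update_of_ne (Finset.ne_of_mem_erase hs')]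
  rw [← Finset.mul_prod_erase Finset.univ _ (Finset.mem_univ s), hl, Function.update_self,
    Matrix.sub_apply, Matrix.mul_apply, Matrix.mul_apply, ← Finset.sum_sub_distrib, Finset.sum_mul]
  refine Finset.sum_congr rfl fun c _ => ?_
  rw [← Finset.mul_prod_erase Finset.univ _ (Finset.mem_univ s),
    ← Finset.mul_prod_erase Finset.univ _ (Finset.mem_univ s), hf, hf, Function.update_self,
    Function.update_self, Function.update_of_ne (by simp), Function.update_of_ne (by simp),
    hBe (σ (e (s, 1))) c]
  ring

end Pfaffian

/-! ### Decomposition into bivectors, Pfaffian and determinant. -/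

section PfaffianDet

/-- A sum over self-maps of a finite type that vanishes off the permutations. -/
lemma sum_fun_eq_of_perm {κ : Type*} [Fintype κ] [DecidableEq κ] {F : (κ → κ) → ℝ} {d : ℝ}
    (h0 : ∀ i, ¬Function.Injective i → F i = 0) (h1 : ∀ π : Equiv.Perm κ, F π = d) :
    ∑ i, F i = (Fintype.card κ).factorial * d := by
  have : ∑ π : Equiv.Perm κ, F π = ∑ i, F i := by
    refine Fintype.sum_of_injective (fun π : Equiv.Perm κ => (π : κ → κ)) DFunLike.coe_injective
      _ _ (fun i hi => h0 i fun hinj => hi ?_) fun _ => rfl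
    exact ⟨Equiv.ofBijective i (Finite.injective_iff_bijective.mp hinj), rfl⟩
  rw [← this]
  simp [h1, Fintype.card_perm]

variable {κ n : Type*} [Fintype κ] [Fintype n] [DecidableEq n]

/-- The matrix whose columns are the vectors of two families, indexed by pairs. -/
def pairCols (e : κ × Fin 2 ≃ n) (u w : κ → n → ℝ) : Matrix n n ℝ :=
  Matrix.of fun r c => if (e.symm c).2 = 0 then u (e.symm c).1 r else w (e.symm c).1 r

/-- Each rank-one factor supplies the entries of two columns, so the sum over `σ` is already the
Leibniz expansion. -/
lemma pfForm_vecMulVec (e : κ × Fin 2 ≃ n) (u w : κ → n → ℝ) :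
    pfForm e (fun s => Matrix.vecMulVec (u s) (w s)) = (pairCols e u w).det := by
  rw [pfForm_apply, Matrix.det_apply]
  refine Finset.sum_congr rfl fun σ _ => ?_
  rw [← Equiv.prod_comp e, Fintype.prod_prod_type, Units.smul_def, zsmul_eq_mul]
  congr 1
  refine Finset.prod_congr rfl fun s _ => ?_
  rw [Fin.prod_univ_two]
  simp [pairCols, Matrix.vecMulVec_apply]

/-- In the multilinear expansion a repeated bivector gives two equal columns and contributes zero;
each of the |κ|! permutations contributes the same term. -/
lemma pfForm_sum_wedge [DecidableEq κ] (e : κ × Fin 2 ≃ n) (u w : κ → n → ℝ) :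
    pfForm e (fun _ => ∑ s, (Matrix.vecMulVec (u s) (w s) -
      (Matrix.vecMulVec (u s) (w s)).transpose)) =
      2 ^ Fintype.card κ * (Fintype.card κ).factorial * (pairCols e u w).det := by
  rw [MultilinearMap.map_sum, sum_fun_eq_of_perm (d := 2 ^ Fintype.card κ * (pairCols e u w).det)]
  · ring
  · intro i hi
    rw [pfForm_sub_transpose e fun s => Matrix.vecMulVec (u (i s)) (w (i s)),
      pfForm_vecMulVec e (fun s => u (i s)) (fun s => w (i s))]
    simp only [Function.Injective, not_forall] at hi
    obtain ⟨s, t, hst, hne⟩ := hi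
    rw [Matrix.det_zero_of_column_eq (i := e (s, 0)) (j := e (t, 0)) (by simpa using hne), mul_zero]
    intro r
    simp [pairCols, hst]
  · intro π
    rw [pfForm_sub_transpose e fun s => Matrix.vecMulVec (u (π s)) (w (π s)),
      ← pfForm_vecMulVec,
      ← pfForm_comp_perm e (fun s => Matrix.vecMulVec (u s) (w s)) π]
    rfl

/-- A skew-symmetric matrix supported on `2k` indices is a sum of `k` simple bivectors. -/
lemma exists_wedge_decomposition : ∀ (k : ℕ) (S : Finset n) (A : Matrix n n ℝ),
    A.transpose = -A → (∀ r c, r ∉ S → A r c = 0) → S.card ≤ 2 * k →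
    ∃ u w : Fin k → n → ℝ, A = ∑ s, (Matrix.vecMulVec (u s) (w s) -
      (Matrix.vecMulVec (u s) (w s)).transpose) := by
  intro k
  induction k with
  | zero =>
    intro S A _ hS hc
    have : S = ∅ := by simpa using hc
    subst this
    refine ⟨0, 0, ?_⟩
    ext r c
    simp [hS r c]
  | succ k ih =>
    intro S A hA hS hc
    have hs : ∀ r c, A c r = -A r c := fun r c => congrFun (congrFun hA r) c
    have hd : ∀ r, A r r = 0 := fun r => by linarith [hs r r]
    by_cases h0 : A = 0
    · refine ⟨0, 0, ?_⟩
      simp [h0]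
    obtain ⟨i, j, ha⟩ : ∃ i j, A i j ≠ 0 := by
      by_contra! h
      exact h0 (by ext r c; simpa using h r c)
    have hi : i ∈ S := by
      by_contra h
      exact ha (hS i j h)
    have hj : j ∈ S := by
      by_contra h
      exact ha (by rw [hs, hS j i h, neg_zero])
    have hij : i ≠ j := by
      rintro rfl
      exact ha (hd i)
    set a := A i j with hadef
    -- Symplectic elimination with pivot `a`: subtracting this bivector clears rows `i` and `j`, and
    -- the support loses two indices.
    set W : Matrix n n ℝ := Matrix.vecMulVec (fun r => -a⁻¹ * A r j) (fun r => A r i) with hW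
    have hskew : (A - (W - W.transpose)).transpose = -(A - (W - W.transpose)) := by
      rw [Matrix.transpose_sub, Matrix.transpose_sub, Matrix.transpose_transpose, hA]
      abel
    have hsupp : ∀ r c, r ∉ (S.erase i).erase j → (A - (W - W.transpose)) r c = 0 := by
      intro r c hr
      simp only [Matrix.sub_apply, Matrix.transpose_apply, hW, Matrix.vecMulVec_apply]
      by_cases h1 : r = j
      · subst h1
        rw [hd r, hs i r, hs c r, ← hadef]
        field_simp
        ring
      by_cases h2 : r = i
      · subst h2
        rw [hd r, hs r c, ← hadef]
        field_simp
        ring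
      · have hrS : r ∉ S := fun h => hr (by simp [h1, h2, h])
        rw [hS r c hrS, hS r i hrS, hS r j hrS]
        ring
    have hcard : ((S.erase i).erase j).card ≤ 2 * k := by
      rw [Finset.card_erase_of_mem (by simp [hij.symm, hj]), Finset.card_erase_of_mem hi]
      omega
    obtain ⟨u, w, huw⟩ := ih _ _ hskew hsupp hcard
    refine ⟨Fin.cons (fun r => -a⁻¹ * A r j) u, Fin.cons (fun r => A r i) w, ?_⟩
    rw [Fin.sum_univ_succ]
    simp only [Fin.cons_zero, Fin.cons_succ]
    rw [← huw, ← hW]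
    abel

/-- The sum of bivectors is G J Gᵀ, where G has the vectors as columns and J consists of 2 × 2
rotation blocks of determinant 1. -/
lemma det_sum_wedge [DecidableEq κ] (e : κ × Fin 2 ≃ n) (u w : κ → n → ℝ) :
    (∑ s, (Matrix.vecMulVec (u s) (w s) - (Matrix.vecMulVec (u s) (w s)).transpose)).det =
      (pairCols e u w).det ^ 2 := by
  set G := (pairCols e u w).submatrix e e with hG
  set Dm : Matrix (κ × Fin 2) (κ × Fin 2) ℝ :=
    Matrix.kroneckerMap (· * ·) (1 : Matrix κ κ ℝ) !![0, 1; -1, 0] with hDm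
  have hD : Dm.det = 1 := by
    rw [hDm, Matrix.det_kronecker]
    simp
  have hE : (∑ s, (Matrix.vecMulVec (u s) (w s) -
      (Matrix.vecMulVec (u s) (w s)).transpose)).submatrix e e = G * Dm * G.transpose := by
    ext r c
    simp only [hG, hDm, Matrix.mul_apply, Fintype.sum_prod_type, Fin.sum_univ_two,
      Matrix.kroneckerMap_apply, Matrix.one_apply, Matrix.submatrix_apply, Matrix.transpose_apply,
      Matrix.sum_apply, Matrix.sub_apply, Matrix.vecMulVec_apply, pairCols, Matrix.of_apply,
      Equiv.symm_apply_apply]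
    refine Finset.sum_congr rfl fun s _ => ?_
    simp
    ring
  rw [← Matrix.det_submatrix_equiv_self e, hE, Matrix.det_mul, Matrix.det_mul, hD,
    Matrix.det_transpose, hG, Matrix.det_submatrix_equiv_self]
  ring

end PfaffianDet

/-! ### The Pfaffian tensor. -/

section PfTensor

variable {ι : Type*} {l : ℕ}

lemma pfaffian_eq (A : Matrix (Fin (2 * l)) (Fin (2 * l)) ℝ) :
    pfaffian A = (1 / ((2 : ℝ) ^ l * (l.factorial : ℝ))) *
      pfForm (pairEquiv l) (fun _ => A) := by
  simp only [pfForm_apply, pairEquiv_zero, pairEquiv_one]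
  rfl

/-- The determinant of a skew-symmetric matrix is the square of its Pfaffian. -/
lemma det_eq_pfaffian_sq (A : Matrix (Fin (2 * l)) (Fin (2 * l)) ℝ) (hA : A.transpose = -A) :
    A.det = pfaffian A ^ 2 := by
  obtain ⟨u, w, rfl⟩ := exists_wedge_decomposition l Finset.univ A hA (by simp) (by simp)
  rw [det_sum_wedge (pairEquiv l), pfaffian_eq, pfForm_sum_wedge, Fintype.card_fin,
    ← mul_assoc, one_div_mul_cancel (by positivity), one_mul]

variable (X : Module.Basis ι ℝ (D l))

lemma pfTensor_eq : pfTensor X = fun i => (1 / ((2 : ℝ) ^ l * (l.factorial : ℝ))) *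
    pfForm (pairEquiv l) (fun s => (X (i s) : Matrix (Fin (2 * l)) (Fin (2 * l)) ℝ)) := by
  funext i
  simp only [pfForm_apply, pairEquiv_zero, pairEquiv_one]
  rfl

lemma isSymmetric_pfTensor : IsSymmetric (pfTensor X) := by
  intro σ i
  rw [pfTensor_eq]
  refine congrArg ((1 / ((2 : ℝ) ^ l * (l.factorial : ℝ))) * ·) ?_
  exact pfForm_comp_perm (pairEquiv l)
    (fun s => (X (i s) : Matrix (Fin (2 * l)) (Fin (2 * l)) ℝ)) σ

variable [Fintype ι]

lemma isInvariant_pfTensor : IsInvariant X (pfTensor X) := by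
  rw [pfTensor_eq]
  exact (isInvariant_of_multilinear X _ fun B hB v =>
    sum_pfForm_commutator (pairEquiv l) B hB v).const_mul _

lemma toPoly_pfTensor (c : ι → ℝ) : toPoly (pfTensor X) c = pfaffian (combo X c) := by
  rw [pfaffian_eq, pfTensor_eq, combo, MultilinearMap.map_sum, Finset.mul_sum]
  refine Finset.sum_congr rfl fun i _ => ?_
  rw [MultilinearMap.map_smul_univ, smul_eq_mul, Algebra.algebraMap_self, RingHom.id_apply]
  ring

end PfTensor

/-! ### The antisymmetrised product of generators. -/

section Epsilon

/-- Reindexing both rows conjugates the summation permutation, which preserves its sign. -/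
lemma epsilon_comp_perm {κ : Type*} [DecidableEq κ] {n : ℕ} (α β : Fin n → κ) (τ : Equiv.Perm (Fin n)) :
    epsilon (α ∘ τ) (β ∘ τ) = epsilon α β := by
  refine Fintype.sum_equiv (MulAut.conj τ).toEquiv _ _ fun σ => ?_
  have h1 : Equiv.Perm.sign ((MulAut.conj τ).toEquiv σ) = Equiv.Perm.sign σ := by
    simp [mul_comm, ← mul_assoc]
  rw [h1]
  congr 1
  refine Fintype.prod_equiv τ _ _ fun s => ?_
  simp

/-- The contraction of `A ⊗ ⋯ ⊗ A` with the generalised Kronecker symbol. -/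
lemma sum_epsilon_mul_prod {n : ℕ} (A : Matrix (Fin n) (Fin n) ℝ) :
    ∑ α : Fin n → Fin n, ∑ β : Fin n → Fin n, epsilon α β * ∏ s, A (α s) (β s) =
      n.factorial * A.det := by
  rw [Finset.sum_comm]
  -- For fixed `β` the Kronecker deltas force α = β ∘ σ, leaving a Leibniz expansion. Only the n!
  -- bijective `β` survive, each giving det A.
  have h : ∀ β : Fin n → Fin n, ∑ α : Fin n → Fin n, epsilon α β * ∏ s, A (α s) (β s) =
      (A.submatrix β β).det := by
    intro β
    simp only [epsilon, Finset.sum_mul]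
    rw [Finset.sum_comm, Matrix.det_apply]
    refine Finset.sum_congr rfl fun σ _ => ?_
    rw [Units.smul_def, zsmul_eq_mul]
    simp only [mul_assoc, ← Finset.prod_mul_distrib]
    rw [← Finset.mul_sum, ← Fintype.prod_sum fun s a => (if a = β (σ s) then (1 : ℝ) else 0) * A a (β s)]
    simp
  simp only [h]
  rw [sum_fun_eq_of_perm (d := A.det), Fintype.card_fin]
  · intro β hβ
    simp only [Function.Injective, not_forall] at hβ
    obtain ⟨s, t, hst, hne⟩ := hβ
    exact Matrix.det_zero_of_row_eq hne (by ext r; simp [hst])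
  · intro π
    exact Matrix.det_submatrix_equiv_self π A

variable {ι : Type*} {l : ℕ} (X : Module.Basis ι ℝ (D l))

/-- The antisymmetrised product of `2l` generators. -/
def epsilonTensor : Tensor ι (2 * l) := fun i =>
  ∑ α : Fin (2 * l) → Fin (2 * l), ∑ β : Fin (2 * l) → Fin (2 * l), epsilon α β *
    ∏ s, (X (i s) : Matrix (Fin (2 * l)) (Fin (2 * l)) ℝ) (α s) (β s)

lemma isSymmetric_epsilonTensor : IsSymmetric (epsilonTensor X) := by
  intro τ i
  refine Fintype.sum_equiv (τ.arrowCongr (Equiv.refl _)) _ _ fun α => ?_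
  refine Fintype.sum_equiv (τ.arrowCongr (Equiv.refl _)) _ _ fun β => ?_
  rw [← epsilon_comp_perm (τ.arrowCongr (Equiv.refl _) α) _ τ]
  congr 1
  · congr 1 <;> · funext s; simp [Equiv.arrowCongr]
  refine Fintype.prod_equiv τ _ _ fun s => ?_
  simp [Equiv.arrowCongr]

lemma toPoly_epsilonTensor [Fintype ι] (c : ι → ℝ) :
    toPoly (epsilonTensor X) c = (2 * l).factorial * (combo X c).det := by
  rw [← sum_epsilon_mul_prod]
  simp only [toPoly, epsilonTensor, Finset.sum_mul, Algebra.algebraMap_self, RingHom.id_apply]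
  rw [Finset.sum_comm]
  refine Finset.sum_congr rfl fun α _ => ?_
  rw [Finset.sum_comm]
  refine Finset.sum_congr rfl fun β _ => ?_
  simp only [combo, Matrix.sum_apply, Matrix.smul_apply, smul_eq_mul]
  rw [Fintype.prod_sum fun s a => c a * (X a : Matrix (Fin (2 * l)) (Fin (2 * l)) ℝ) (α s) (β s),
    Finset.mul_sum]
  refine Finset.sum_congr rfl fun i _ => ?_
  rw [Finset.prod_mul_distrib]
  ring

lemma epsilonTensor_eq [Fintype ι] : epsilonTensor X =
    ((2 * l).factorial : ℝ) • symProd (two_mul l).symm (pfTensor X) (pfTensor X) := by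
  refine (isSymmetric_epsilonTensor X).ext (fun σ i => ?_) fun c => ?_
  · simp only [Pi.smul_apply, isSymmetric_symProd _ _ _ σ i]
  · rw [toPoly_epsilonTensor, toPoly_smul, toPoly_symProd, toPoly_pfTensor,
      det_eq_pfaffian_sq _ (combo_transpose X c), sq]
    rfl

end Epsilon

/-! ### From infinitesimal invariance to Weyl reflections. -/

section Rotation

variable {ι : Type*} [Fintype ι] {𝔤 : Type*} [LieRing 𝔤] [LieAlgebra ℝ 𝔤]
  {X : Module.Basis ι ℝ 𝔤}

lemma hasDerivAt_toPoly {m : ℕ} (h : Tensor ι m) {c : ℝ → ι → ℂ} {c' : ι → ℂ} {t : ℝ}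
    (hc : ∀ i, HasDerivAt (fun t => c t i) (c' i) t) :
    HasDerivAt (fun t => toPoly h (c t))
      (∑ i, (h i : ℂ) * ∑ s, (∏ r ∈ Finset.univ.erase s, c t (i r)) * c' (i s)) t := by
  unfold toPoly
  refine HasDerivAt.fun_sum fun i _ => ?_
  refine HasDerivAt.const_mul _ ?_
  have := HasDerivAt.fun_finsetProd (u := Finset.univ) (f := fun s t => c t (i s))
    (f' := fun s => c' (i s)) (x := t) fun s _ => hc (i s)
  simpa only [smul_eq_mul] using this

/-- An invariant polynomial is constant along the orbits of one-parameter rotation groups. -/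
lemma IsInvariant.toPoly_rotation {m : ℕ} {h : Tensor ι m} (hh : IsInvariant X h) {B : 𝔤}
    {P Q R : ι → ℂ} (hP : adCoord X B P = 0) (hQ : adCoord X B Q = (2 : ℂ) • R)
    (hR : adCoord X B R = (-2 : ℂ) • Q) : toPoly h (P + Q) = toPoly h (P - Q) := by
  -- This curve solves c' = ad_B c. The factor 2 in the angle matches the eigenvalues ±2i on the
  -- span of `Q` and `R`, so time π/2 is a half turn.
  set c : ℝ → ι → ℂ := fun t =>
    P + ((Real.cos (2 * t) : ℝ) : ℂ) • Q + ((Real.sin (2 * t) : ℝ) : ℂ) • R with hc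
  have hd : ∀ t, HasDerivAt (fun t => toPoly h (c t)) 0 t := by
    intro t
    have h1 : ∀ i, HasDerivAt (fun t => c t i) (adCoord X B (c t) i) t := by
      intro i
      have hcos : HasDerivAt (fun t : ℝ => ((Real.cos (2 * t) : ℝ) : ℂ))
          ((-Real.sin (2 * t) * 2 : ℝ) : ℂ) t := by
        have := ((hasDerivAt_id t).const_mul 2).cos
        simp only [id, mul_one] at this
        exact this.ofReal_comp
      have hsin : HasDerivAt (fun t : ℝ => ((Real.sin (2 * t) : ℝ) : ℂ))
          ((Real.cos (2 * t) * 2 : ℝ) : ℂ) t := by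
        have := ((hasDerivAt_id t).const_mul 2).sin
        simp only [id, mul_one] at this
        exact this.ofReal_comp
      have hsum := ((hcos.mul_const (Q i)).const_add (P i)).add (hsin.mul_const (R i))
      have hval : adCoord X B (c t) i =
          ((-Real.sin (2 * t) * 2 : ℝ) : ℂ) * Q i + ((Real.cos (2 * t) * 2 : ℝ) : ℂ) * R i := by
        simp only [hc, adCoord_add, adCoord_smul, hP, hQ, hR, Pi.add_apply, Pi.smul_apply,
          Pi.zero_apply, smul_eq_mul]
        push_cast
        ring
      rw [hval]
      exact hsum
    have := hasDerivAt_toPoly h h1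
    rwa [hh.sum_adCoord B (c t)] at this
  have hconst := is_const_of_deriv_eq_zero (fun t => (hd t).differentiableAt)
    (fun t => (hd t).deriv) 0 (Real.pi / 2)
  have e0 : c 0 = P + Q := by simp [hc]
  have e1 : c (Real.pi / 2) = P - Q := by
    simp [hc, mul_div_cancel₀, sub_eq_add_neg]
  simpa only [e0, e1] using hconst

/-- The complex point with given coordinates with respect to a family of Lie algebra elements. -/
def torusPoint (X : Module.Basis ι ℝ 𝔤) {κ : Type*} [Fintype κ] (v : κ → 𝔤) :
    (κ → ℂ) →ₗ[ℂ] (ι → ℂ) :=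
  Fintype.linearCombination ℂ fun a => coordC X (v a)

lemma torusPoint_apply {ι : Type*} {X : Module.Basis ι ℝ 𝔤} {κ : Type*} [Fintype κ] (v : κ → 𝔤) (x : κ → ℂ) :
    torusPoint X v x = ∑ a, x a • coordC X (v a) := rfl

lemma adCoord_torusPoint {κ : Type*} [Fintype κ] (B : 𝔤) (v : κ → 𝔤) (x : κ → ℂ) :
    adCoord X B (torusPoint X v x) = ∑ a, x a • coordC X ⁅B, v a⁆ := by
  simp only [← adCoord_coordC, torusPoint_apply]
  funext ρ
  simp only [adCoord, Finset.sum_apply, Pi.smul_apply, smul_eq_mul, Finset.sum_mul,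
    Finset.mul_sum]
  rw [Finset.sum_comm]
  exact Finset.sum_congr rfl fun _ _ => Finset.sum_congr rfl fun _ _ => by ring

lemma coordC_smul {ι : Type*} {X : Module.Basis ι ℝ 𝔤} (r : ℝ) (M : 𝔤) : coordC X (r • M) = (r : ℂ) • coordC X M := by
  funext i
  simp [coordC]

lemma coordC_add {ι : Type*} {X : Module.Basis ι ℝ 𝔤} (M N : 𝔤) : coordC X (M + N) = coordC X M + coordC X N := by
  funext i
  simp [coordC]

lemma coordC_zero {ι : Type*} {X : Module.Basis ι ℝ 𝔤} : coordC X (0 : 𝔤) = 0 := by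
  funext i
  simp [coordC]

/-- The reflection in a root, from the corresponding subalgebra of rank one. -/
lemma IsInvariant.toPoly_reflection {m : ℕ} {h : Tensor ι m} (hh : IsInvariant X h)
    {κ : Type*} [Fintype κ] [DecidableEq κ] {v : κ → 𝔤} {a b : κ} (hab : a ≠ b) {B K : 𝔤} {ε : ℝ}
    (hε : ε * ε = 1) (h0 : ∀ k, k ≠ a → k ≠ b → ⁅B, v k⁆ = 0) (ha : ⁅B, v a⁆ = K)
    (hb : ⁅B, v b⁆ = ε • K) (hK : ⁅B, K⁆ = (-2 : ℝ) • (v a + ε • v b)) (x : κ → ℂ) :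
    toPoly h (torusPoint X v (Function.update (Function.update x a (-ε * x b)) b (-ε * x a))) =
      toPoly h (torusPoint X v x) := by
  have hε' : (ε : ℂ) * ε = 1 := by exact_mod_cast hε
  have hsum : ∀ y : κ → ℂ, adCoord X B (torusPoint X v y) = (y a + ε * y b) • coordC X K := by
    intro y
    rw [adCoord_torusPoint, Fintype.sum_eq_add a b hab, ha, hb, coordC_smul, smul_smul, add_smul,
      mul_comm]
    intro k hk
    rw [h0 k hk.1 hk.2, coordC_zero, smul_zero]
  -- `d` is the component of `x` along the root direction, and `x - d` is killed by ad_B. The half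
  -- turn sends `x` to `x - 2d`, its reflection.
  set z : ℂ := (x a + ε * x b) / 2 with hz
  set d : κ → ℂ := Pi.single a z + Pi.single b (ε * z) with hd
  have hda : d a = z := by simp [hd, hab]
  have hdb : d b = ε * z := by simp [hd, hab.symm]
  have hdk : ∀ k, k ≠ a → k ≠ b → d k = 0 := fun k h1 h2 => by simp [hd, h1, h2]
  have hrot := hh.toPoly_rotation (B := B) (P := torusPoint X v (x - d)) (Q := torusPoint X v d)
    (R := z • coordC X K) ?_ ?_ ?_
  · rw [← map_add, ← map_sub, sub_add_cancel] at hrot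
    rw [hrot]
    congr 2
    funext k
    by_cases h1 : k = b
    · subst h1
      simp only [Function.update_self, Pi.sub_apply, hdb, hz]
      linear_combination (x k) * hε'
    by_cases h2 : k = a
    · subst h2
      simp only [Function.update_of_ne h1, Function.update_self, Pi.sub_apply, hda, hz]
      ring
    · simp [h1, h2, hdk]
  · rw [hsum, Pi.sub_apply, Pi.sub_apply, hda, hdb]
    rw [show x a - z + ε * (x b - ε * z) = 0 by
      simp only [hz]
      linear_combination (-(x a + ε * x b) / 2) * hε', zero_smul]
  · rw [hsum, hda, hdb, smul_smul]
    congr 1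
    linear_combination z * hε'
  · rw [adCoord_smul, adCoord_coordC, hK, coordC_smul, coordC_add, coordC_smul, torusPoint_apply,
      Fintype.sum_eq_add a b hab (fun k hk => by rw [hdk k hk.1 hk.2, zero_smul]), hda, hdb,
      smul_comm]
    push_cast
    simp only [smul_add, smul_smul]
    congr 2
    ring

end Rotation

/-! ### The Cartan subalgebra, its Weyl group and indecomposability of the traces. -/

section Torus

variable {l : ℕ}

open Matrix

/-- Kronecker product with `2 × 2` blocks, as a `2l × 2l` matrix. -/
def blockKron {K : Type*} [CommRing K] (P : Matrix (Fin l) (Fin l) K) (Q : Matrix (Fin 2) (Fin 2) K) :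
    Matrix (Fin (2 * l)) (Fin (2 * l)) K :=
  Matrix.reindexAlgEquiv K K (pairEquiv l) (Matrix.kroneckerMap (· * ·) P Q)

section

variable {K : Type*} [CommRing K]

lemma blockKron_mul (P P' : Matrix (Fin l) (Fin l) K) (Q Q' : Matrix (Fin 2) (Fin 2) K) :
    blockKron P Q * blockKron P' Q' = blockKron (P * P') (Q * Q') := by
  rw [blockKron, blockKron, ← map_mul, ← Matrix.mul_kronecker_mul]
  rfl

lemma blockKron_pow (P : Matrix (Fin l) (Fin l) K) (Q : Matrix (Fin 2) (Fin 2) K) (k : ℕ) :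
    blockKron P Q ^ k = blockKron (P ^ k) (Q ^ k) := by
  induction k with
  | zero => simp [blockKron]
  | succ k ih => rw [pow_succ, ih, blockKron_mul, ← pow_succ, ← pow_succ]

lemma blockKron_trace (P : Matrix (Fin l) (Fin l) K) (Q : Matrix (Fin 2) (Fin 2) K) :
    (blockKron P Q).trace = P.trace * Q.trace := by
  rw [← Matrix.trace_kronecker, blockKron, Matrix.coe_reindexAlgEquiv]
  exact Fintype.sum_equiv (pairEquiv l).symm _ _ fun _ => rfl

lemma blockKron_transpose (P : Matrix (Fin l) (Fin l) K) (Q : Matrix (Fin 2) (Fin 2) K) :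
    (blockKron P Q)ᵀ = blockKron Pᵀ Qᵀ := rfl

lemma blockKron_apply (P : Matrix (Fin l) (Fin l) K) (Q : Matrix (Fin 2) (Fin 2) K) (i j) :
    blockKron P Q i j = P ((pairEquiv l).symm i).1 ((pairEquiv l).symm j).1 *
      Q ((pairEquiv l).symm i).2 ((pairEquiv l).symm j).2 := rfl

lemma blockKron_sub_left (P P' : Matrix (Fin l) (Fin l) K) (Q : Matrix (Fin 2) (Fin 2) K) :
    blockKron (P - P') Q = blockKron P Q - blockKron P' Q := by
  ext i j
  simp [blockKron_apply, sub_mul]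

lemma blockKron_add_left (P P' : Matrix (Fin l) (Fin l) K) (Q : Matrix (Fin 2) (Fin 2) K) :
    blockKron (P + P') Q = blockKron P Q + blockKron P' Q := by
  ext i j
  simp [blockKron_apply, add_mul]

lemma blockKron_zero_left (Q : Matrix (Fin 2) (Fin 2) K) :
    blockKron (0 : Matrix (Fin l) (Fin l) K) Q = 0 := by
  ext i j
  simp [blockKron_apply]

lemma blockKron_neg_left (P : Matrix (Fin l) (Fin l) K) (Q : Matrix (Fin 2) (Fin 2) K) :
    blockKron (-P) Q = -blockKron P Q := by
  ext i j
  simp [blockKron_apply]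

lemma blockKron_neg_right (P : Matrix (Fin l) (Fin l) K) (Q : Matrix (Fin 2) (Fin 2) K) :
    blockKron P (-Q) = -blockKron P Q := by
  ext i j
  simp [blockKron_apply]

end

/-- The rotation by a quarter turn, over any ring. -/
abbrev rot (K : Type*) [CommRing K] : Matrix (Fin 2) (Fin 2) K := !![0, 1; -1, 0]

/-- The reflection in the first coordinate axis. -/
abbrev reflA : Matrix (Fin 2) (Fin 2) ℝ := !![1, 0; 0, -1]

/-- The reflection exchanging the two coordinates. -/
abbrev reflB : Matrix (Fin 2) (Fin 2) ℝ := !![0, 1; 1, 0]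

lemma transpose_rot (K : Type*) [CommRing K] : (rot K)ᵀ = -rot K := by
  ext i j; fin_cases i <;> fin_cases j <;> simp

lemma transpose_reflA : reflAᵀ = reflA := by
  ext i j; fin_cases i <;> fin_cases j <;> simp

lemma transpose_reflB : reflBᵀ = reflB := by
  ext i j; fin_cases i <;> fin_cases j <;> simp

lemma reflA_mul_rot : reflA * rot ℝ = reflB := by
  ext i j; fin_cases i <;> fin_cases j <;> simp

lemma rot_mul_reflA : rot ℝ * reflA = -reflB := by
  ext i j; fin_cases i <;> fin_cases j <;> simp

lemma reflA_mul_reflB : reflA * reflB = rot ℝ := by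
  ext i j; fin_cases i <;> fin_cases j <;> simp

lemma reflB_mul_reflA : reflB * reflA = -rot ℝ := by
  ext i j; fin_cases i <;> fin_cases j <;> simp

/-- An element of `so(2l)` given by a symmetric matrix and the skew block. -/
def ofSymm (P : Matrix (Fin l) (Fin l) ℝ) (hP : Pᵀ = P) : D l :=
  ⟨blockKron P (rot ℝ), (LieAlgebra.Orthogonal.mem_so _ _ _).mpr (by
    rw [blockKron_transpose, hP, transpose_rot, blockKron_neg_right])⟩

/-- An element of `so(2l)` given by a skew-symmetric matrix and a symmetric block. -/
def ofSkew (P : Matrix (Fin l) (Fin l) ℝ) (hP : Pᵀ = -P) (Q : Matrix (Fin 2) (Fin 2) ℝ)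
    (hQ : Qᵀ = Q) : D l :=
  ⟨blockKron P Q, (LieAlgebra.Orthogonal.mem_so _ _ _).mpr (by
    rw [blockKron_transpose, hP, hQ, blockKron_neg_left])⟩

/-- The rotation generators of the standard Cartan subalgebra. -/
def cartan (a : Fin l) : D l :=
  ofSymm (Matrix.single a a 1) (by simp)

lemma transpose_single_sub (a b : Fin l) : (Matrix.single a b (1 : ℝ) - Matrix.single b a 1)ᵀ =
    -(Matrix.single a b (1 : ℝ) - Matrix.single b a 1) := by
  simp

lemma bracket_coe (A B : D l) :
    ((⁅A, B⁆ : D l) : Matrix (Fin (2 * l)) (Fin (2 * l)) ℝ) = A.1 * B.1 - B.1 * A.1 := rfl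

variable {ι : Type*} [Fintype ι] {X : Module.Basis ι ℝ (D l)}

/-- The reflection in the root e_a - e_b, that is, ε = -1. -/
lemma IsInvariant.toPoly_swap {m : ℕ} {h : Tensor ι m} (hh : IsInvariant X h) {a b : Fin l}
    (hab : a ≠ b) (x : Fin l → ℂ) :
    toPoly h (torusPoint X cartan (x ∘ Equiv.swap a b)) = toPoly h (torusPoint X cartan x) := by
  have := hh.toPoly_reflection hab (v := cartan) (ε := -1)
    (B := ofSkew (Matrix.single a b (1 : ℝ) - Matrix.single b a 1) (transpose_single_sub a b) 1
      (by simp))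
    (K := ofSymm (-(Matrix.single a b (1 : ℝ) + Matrix.single b a 1)) (by simp [add_comm]))
    (by norm_num) ?_ ?_ ?_ ?_ x
  · rw [← this]
    congr 2
    funext k
    by_cases h1 : k = b
    · subst h1; simp
    by_cases h2 : k = a
    · subst h2; simp [h1]
    · simp [h1, h2, Equiv.swap_apply_of_ne_of_ne h2 h1]
  · intro k hka hkb
    apply Subtype.ext
    rw [bracket_coe]
    simp [ofSkew, cartan, ofSymm, blockKron_mul, sub_mul, mul_sub, hka, hkb, hka.symm, hkb.symm,
      blockKron_zero_left]
  · apply Subtype.ext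
    rw [bracket_coe]
    simp [ofSkew, cartan, ofSymm, blockKron_mul, sub_mul, mul_sub, hab, hab.symm,
      blockKron_sub_left, blockKron_neg_left, blockKron_add_left, blockKron_zero_left]
    abel
  · apply Subtype.ext
    rw [bracket_coe]
    simp [ofSkew, cartan, ofSymm, blockKron_mul, sub_mul, mul_sub, hab, hab.symm,
      blockKron_sub_left, blockKron_neg_left, blockKron_add_left, blockKron_zero_left]
  · apply Subtype.ext
    rw [bracket_coe]
    simp [ofSkew, cartan, ofSymm, blockKron_mul, sub_mul, mul_sub, mul_add, add_mul, hab, hab.symm,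
      blockKron_sub_left, blockKron_neg_left, blockKron_add_left, blockKron_zero_left]
    module

/-- The reflection in the root e_a + e_b, that is, ε = 1. -/
lemma IsInvariant.toPoly_neg_swap {m : ℕ} {h : Tensor ι m} (hh : IsInvariant X h) {a b : Fin l}
    (hab : a ≠ b) (x : Fin l → ℂ) :
    toPoly h (torusPoint X cartan (Function.update (Function.update x a (-x b)) b (-x a))) =
      toPoly h (torusPoint X cartan x) := by
  have := hh.toPoly_reflection hab (v := cartan) (ε := 1)
    (B := ofSkew (Matrix.single a b (1 : ℝ) - Matrix.single b a 1) (transpose_single_sub a b) reflA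
      transpose_reflA)
    (K := ofSkew (Matrix.single a b (1 : ℝ) - Matrix.single b a 1) (transpose_single_sub a b) reflB
      transpose_reflB)
    (by norm_num) ?_ ?_ ?_ ?_ x
  · rw [← this]
    simp
  · intro k hka hkb
    apply Subtype.ext
    rw [bracket_coe]
    simp only [ofSkew, cartan, ofSymm, blockKron_mul]
    simp [sub_mul, mul_sub, hka, hkb, hka.symm, hkb.symm, blockKron_zero_left]
  · apply Subtype.ext
    rw [bracket_coe]
    simp only [ofSkew, cartan, ofSymm, blockKron_mul, reflA_mul_rot, rot_mul_reflA, blockKron_neg_right]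
    simp [sub_mul, mul_sub, hab, hab.symm, blockKron_sub_left, blockKron_neg_left]
    abel
  · apply Subtype.ext
    rw [bracket_coe]
    simp only [ofSkew, cartan, ofSymm, blockKron_mul, reflA_mul_rot, rot_mul_reflA, blockKron_neg_right]
    simp [sub_mul, mul_sub, hab, hab.symm, blockKron_sub_left, blockKron_neg_left]
  · apply Subtype.ext
    rw [bracket_coe]
    simp only [ofSkew, cartan, ofSymm, blockKron_mul, reflA_mul_reflB, reflB_mul_reflA, blockKron_neg_right]
    simp [sub_mul, mul_sub, hab, hab.symm, blockKron_sub_left, blockKron_neg_left]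
    module

lemma IsInvariant.toPoly_perm {m : ℕ} {h : Tensor ι m} (hh : IsInvariant X h)
    (π : Equiv.Perm (Fin l)) (x : Fin l → ℂ) :
    toPoly h (torusPoint X cartan (x ∘ π)) = toPoly h (torusPoint X cartan x) := by
  induction π using Equiv.Perm.swap_induction_on generalizing x with
  | one => simp
  | swap_mul f a b hab ih =>
    rw [Equiv.Perm.coe_mul, ← Function.comp_assoc, ih, hh.toPoly_swap hab]

/-- The product of the reflections in e_a - e_b and e_a + e_b. Signs change in pairs, as in the Weyl
group of type D. -/
lemma IsInvariant.toPoly_flip {m : ℕ} {h : Tensor ι m} (hh : IsInvariant X h) {a b : Fin l}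
    (hab : a ≠ b) (x : Fin l → ℂ) :
    toPoly h (torusPoint X cartan (Function.update (Function.update x a (-x a)) b (-x b))) =
      toPoly h (torusPoint X cartan x) := by
  rw [← hh.toPoly_swap hab x, ← hh.toPoly_neg_swap hab (x ∘ Equiv.swap a b)]
  congr 2
  funext k
  by_cases h1 : k = b
  · subst h1; simp
  by_cases h2 : k = a
  · subst h2; simp [h1]
  · simp [h1, h2, Equiv.swap_apply_of_ne_of_ne h2 h1]

/-- The eigenvector of a Coxeter-type element: consecutive powers of `η` in `j` places. -/
def cyclicPoint (l j : ℕ) (η : ℂ) : Fin l → ℂ := fun k => if (k : ℕ) < j then η ^ (k : ℕ) else 0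

/-- Invariant polynomials of low positive degree vanish at `cyclicPoint`. -/
lemma IsInvariant.toPoly_cyclicPoint {m j : ℕ} {h : Tensor ι m} (hh : IsInvariant X h)
    (hm : 0 < m) (hmj : m < 2 * j) (hj : j < l) {η : ℂ} (hη : IsPrimitiveRoot η (2 * j)) :
    toPoly h (torusPoint X cartan (cyclicPoint l j η)) = 0 := by
  have hj0 : 0 < j := by omega
  have : NeZero l := ⟨by omega⟩
  have hηj : η ^ j = -1 := by
    have h1 : (η ^ j - 1) * (η ^ j + 1) = 0 := by
      have := hη.pow_eq_one
      rw [mul_comm, pow_mul] at this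
      linear_combination this
    rcases mul_eq_zero.mp h1 with h2 | h2
    · have := hη.dvd_of_pow_eq_one j (sub_eq_zero.mp h2)
      have := Nat.le_of_dvd hj0 this
      omega
    · exact eq_neg_of_add_eq_zero_left h2
  set a : Fin l := ⟨j - 1, by omega⟩ with ha
  -- Since j < l, the last coordinate is zero. Flipping its sign is harmless and makes the sign
  -- change at `a` an even one.
  set b : Fin l := ⟨l - 1, by omega⟩ with hb
  have hab : a ≠ b := by
    simp only [ha, hb, ne_eq, Fin.mk.injEq]
    omega
  set x := cyclicPoint l j η with hx
  set y := x ∘ Fin.cycleRange a with hy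
  have hyb : y b = 0 := by
    have hlt : a < b := by
      simp only [ha, hb, Fin.mk_lt_mk]
      omega
    have hfix : Fin.cycleRange a b = b := Fin.cycleRange_of_gt hlt
    simp only [hy, Function.comp_apply, hfix, hx, cyclicPoint]
    exact if_neg (by simp only [hb]; omega)
  have hya : y a = 1 := by
    simp only [hy, Function.comp_apply, Fin.cycleRange_of_eq rfl, hx, cyclicPoint]
    simp [hj0]
  -- The cycle shifts the powers of η by one place and brings 1 to position j - 1; the flip turns it
  -- into -1 = η^j. The result is η times the original vector.
  have hflip : Function.update (Function.update y a (-y a)) b (-y b) = η • x := by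
    funext k
    rw [Pi.smul_apply, smul_eq_mul]
    by_cases h1 : k = b
    · subst h1
      rw [Function.update_self, hyb]
      simp only [hx, cyclicPoint, hb]
      rw [if_neg (by omega)]
      ring
    rw [Function.update_of_ne h1]
    by_cases h2 : k = a
    · subst h2
      rw [Function.update_self, hya, ← hηj]
      simp only [hx, cyclicPoint, ha]
      rw [if_pos (by omega), ← pow_succ']
      congr 1
      omega
    rw [Function.update_of_ne h2]
    rcases lt_or_gt_of_ne h2 with h3 | h3
    · have h3' : (k : ℕ) < j - 1 := h3
      have hk1 : ((k + 1 : Fin l) : ℕ) = k + 1 := Fin.val_add_one_of_lt' (by omega)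
      simp only [hy, Function.comp_apply, Fin.cycleRange_of_lt h3, hx, cyclicPoint, hk1]
      rw [if_pos (by omega), if_pos (by omega), pow_succ']
    · have h3' : j - 1 < (k : ℕ) := h3
      simp only [hy, Function.comp_apply, Fin.cycleRange_of_gt h3, hx, cyclicPoint]
      rw [if_neg (by omega)]
      ring
  have h1 := hh.toPoly_flip hab y
  rw [hflip, map_smul, toPoly_smul_right, hh.toPoly_perm] at h1
  have h2 : (η ^ m - 1) * toPoly h (torusPoint X cartan x) = 0 := by linear_combination h1
  refine (mul_eq_zero.mp h2).resolve_left fun h3 => ?_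
  have := Nat.le_of_dvd hm (hη.dvd_of_pow_eq_one m (sub_eq_zero.mp h3))
  omega

lemma comboIn_coordC (M : D l) : comboIn X (coordC X M) =
    (M : Matrix (Fin (2 * l)) (Fin (2 * l)) ℝ).map (algebraMap ℝ ℂ) := by
  have hM : (M : Matrix (Fin (2 * l)) (Fin (2 * l)) ℝ) =
      ∑ i, X.repr M i • (X i : Matrix (Fin (2 * l)) (Fin (2 * l)) ℝ) := by
    conv_lhs => rw [← X.sum_repr M, AddSubmonoidClass.coe_finsetSum]
    rfl
  ext i j
  rw [Matrix.map_apply, hM]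
  simp [comboIn, coordC, Matrix.sum_apply]

lemma comboIn_torusPoint (x : Fin l → ℂ) :
    comboIn X (torusPoint X cartan x) = blockKron (Matrix.diagonal x) (rot ℂ) := by
  have h1 : comboIn X (torusPoint X cartan x) = ∑ a, x a • comboIn X (coordC X (cartan a)) := by
    simp only [comboIn, torusPoint_apply, Finset.sum_apply, Pi.smul_apply, smul_eq_mul,
      Finset.sum_smul, Finset.smul_sum, mul_smul]
    exact Finset.sum_comm
  rw [h1]
  ext i j
  simp only [comboIn_coordC, Matrix.sum_apply, Matrix.smul_apply, Matrix.map_apply, cartan, ofSymm,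
    blockKron_apply, Matrix.single_apply, Matrix.diagonal_apply, smul_eq_mul, map_mul]
  have h2 : ∀ p q, algebraMap ℝ ℂ (rot ℝ p q) = rot ℂ p q := by
    intro p q
    fin_cases p <;> fin_cases q <;> simp
  simp only [h2, ← mul_assoc, ← Finset.sum_mul]
  congr 1
  by_cases h3 : ((pairEquiv l).symm i).1 = ((pairEquiv l).symm j).1
  · simp [h3]
  · rw [if_neg h3]
    refine Finset.sum_eq_zero fun a _ => ?_
    rw [if_neg (by rintro ⟨h4, h5⟩; exact h3 (h4.symm.trans h5))]
    simp

/-- Each of the j nonzero coordinates has 2j-th power 1, and the rotation block squares to -1, so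
the value is 2j(-1)^j. -/
lemma toPoly_symTrace_cyclicPoint {j : ℕ} (hj0 : 0 < j) (hj : j < l) {η : ℂ}
    (hη : IsPrimitiveRoot η (2 * j)) :
    toPoly (symTrace X (2 * j)) (torusPoint X cartan (cyclicPoint l j η)) ≠ 0 := by
  rw [toPoly_symTrace, comboIn_torusPoint, blockKron_pow, blockKron_trace, Matrix.diagonal_pow,
    Matrix.trace_diagonal]
  have h1 : ∑ k, (cyclicPoint l j η ^ (2 * j)) k = j := by
    have : ∀ k : Fin l, (cyclicPoint l j η ^ (2 * j)) k = if (k : ℕ) < j then 1 else 0 := by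
      intro k
      simp only [Pi.pow_apply, cyclicPoint]
      split_ifs
      · rw [← pow_mul, mul_comm, pow_mul, hη.pow_eq_one, one_pow]
      · rw [zero_pow (by omega)]
    simp only [this]
    rw [Fin.sum_univ_eq_sum_range (fun k => if k < j then (1 : ℂ) else 0), ← Finset.sum_filter,
      Finset.sum_const, nsmul_one]
    congr 1
    have : (Finset.range l).filter (· < j) = Finset.range j := by
      ext k
      simp only [Finset.mem_filter, Finset.mem_range]
      omega
    rw [this, Finset.card_range]
  have h2 : rot ℂ ^ (2 * j) = (-1 : ℂ) ^ j • (1 : Matrix (Fin 2) (Fin 2) ℂ) := by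
    have : rot ℂ ^ 2 = (-1 : ℂ) • (1 : Matrix (Fin 2) (Fin 2) ℂ) := by
      rw [sq]
      ext p q
      fin_cases p <;> fin_cases q <;> simp
    rw [pow_mul, this, smul_pow, one_pow]
  rw [h1, h2, Matrix.trace_smul, Matrix.trace_one]
  simp
  omega

/-- The symmetric traces of even order less than `2l` are indecomposable. -/
lemma symTrace_notMem_decomposable {j : ℕ} (hj0 : 0 < j) (hj : j < l) :
    symTrace X (2 * j) ∉ decomposable X (2 * j) := by
  intro hmem
  have hη := Complex.isPrimitiveRoot_exp (2 * j) (by omega)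
  refine toPoly_symTrace_cyclicPoint (X := X) hj0 hj hη ?_
  refine Submodule.span_induction (p := fun t _ => toPoly t (torusPoint X cartan
    (cyclicPoint l j (Complex.exp (2 * Real.pi * Complex.I / (2 * j : ℕ))))) = 0)
    ?_ ?_ ?_ ?_ hmem
  · rintro t ⟨p, q, e, h, h', hp, hq, _, hi, _, _, rfl⟩
    rw [toPoly_symProd, hi.toPoly_cyclicPoint hp (by omega) hj hη, zero_mul]
  · exact toPoly_zero _
  · intro t t' _ _ h1 h2
    rw [toPoly_add, h1, h2, add_zero]
  · intro r t _ h1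
    rw [toPoly_smul, h1, mul_zero]

end Torus

/-! ### Generation of the higher traces by the basic tensors. -/

section Generation

variable {ι : Type*} [Fintype ι] {l : ℕ} {X : Module.Basis ι ℝ (D l)}

/-- Tensors generated by the basic ones are symmetric and invariant, and decomposable when their
order exceeds those of the basic ones. -/
lemma GeneratedBy.properties (hl : 1 ≤ l) {m : ℕ} {t : Tensor ι m}
    (ht : GeneratedBy (basicTensors X) m t) :
    IsSymmetric t ∧ IsInvariant X t ∧ (m = 0 → t = 0) ∧ (2 * l ≤ m → t ∈ decomposable X m) := by
  induction ht with
  | of hS =>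
    rcases hS with ⟨k, _, h2, hk, he⟩ | he
    · cases he
      exact ⟨isSymmetric_symTrace X _, isInvariant_symTrace X _, fun h => by omega,
        fun h => by omega⟩
    · cases he
      exact ⟨isSymmetric_pfTensor X, isInvariant_pfTensor X, fun h => by omega,
        fun h => by omega⟩
  | zero m =>
    exact ⟨fun _ _ => rfl, fun _ _ => by simp, fun _ => rfl, fun _ => Submodule.zero_mem _⟩
  | add _ _ ih ih' =>
    obtain ⟨s, i, z, d⟩ := ih
    obtain ⟨s', i', z', d'⟩ := ih'
    refine ⟨fun σ j => ?_, i.add i', fun h => by rw [z h, z' h, add_zero],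
      fun h => Submodule.add_mem _ (d h) (d' h)⟩
    simp only [Pi.add_apply, s σ j, s' σ j]
  | smul c _ ih =>
    obtain ⟨s, i, z, d⟩ := ih
    refine ⟨fun σ j => ?_, i.const_mul c, fun h => by rw [z h, smul_zero],
      fun h => Submodule.smul_mem _ c (d h)⟩
    simp only [Pi.smul_apply, s σ j]
  | @mul p q m e t t' _ _ ih ih' =>
    obtain ⟨s, i, z, d⟩ := ih
    obtain ⟨s', i', z', d'⟩ := ih'
    -- `GeneratedBy` allows factors of order zero but `decomposable` does not. The basic tensors
    -- have positive order, so generated tensors of order zero vanish and such products are zero.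
    have hzero : p = 0 ∨ q = 0 → symProd e t t' = 0 := by
      rintro (h | h)
      · rw [z h]; funext j; simp [symProd]
      · rw [z' h]; funext j; simp [symProd]
    refine ⟨isSymmetric_symProd e t t', i.symProd e i', fun h => hzero (by omega), fun h => ?_⟩
    by_cases h0 : p = 0 ∨ q = 0
    · rw [hzero h0]
      exact Submodule.zero_mem _
    · exact Submodule.subset_span ⟨p, q, e, t, t', by omega, by omega, s, i, s', i', rfl⟩

/-- The polynomial functions of the generated tensors of a given order. -/
def generatedPoly (X : Module.Basis ι ℝ (D l)) (m : ℕ) : Submodule ℝ ((ι → ℝ) → ℝ) where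
  carrier := {F | ∃ t, GeneratedBy (basicTensors X) m t ∧ ∀ c, toPoly t c = F c}
  add_mem' := by
    rintro F F' ⟨t, ht, hF⟩ ⟨t', ht', hF'⟩
    exact ⟨t + t', ht.add ht', fun c => by rw [toPoly_add, hF, hF', Pi.add_apply]⟩
  zero_mem' := ⟨0, .zero m, fun c => toPoly_zero c⟩
  smul_mem' := by
    rintro r F ⟨t, ht, hF⟩
    exact ⟨r • t, ht.smul r, fun c => by rw [toPoly_smul, hF]; rfl⟩

lemma mul_mem_generatedPoly {p q m : ℕ} (e : p + q = m) {F F' : (ι → ℝ) → ℝ}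
    (hF : F ∈ generatedPoly X p) (hF' : F' ∈ generatedPoly X q) :
    F * F' ∈ generatedPoly X m := by
  obtain ⟨t, ht, hF⟩ := hF
  obtain ⟨t', ht', hF'⟩ := hF'
  exact ⟨symProd e t t', ht.mul e ht', fun c => by rw [toPoly_symProd, hF, hF', Pi.mul_apply]⟩

lemma pfaffian_mem_generatedPoly :
    (fun c => pfaffian (combo X c)) ∈ generatedPoly X l :=
  ⟨pfTensor X, .of (Or.inr rfl), toPoly_pfTensor X⟩

/-- Strong induction carries the trace and E_k together. Below order 2l the trace is basic or zero,
and Newton's identity is solved for E_k, whose coefficient ±k is invertible. From 2l on, E_k is Pf²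
or 0, and the identity gives the trace. -/
lemma trace_pow_mem_generatedPoly (k : ℕ) (hk : 0 < k) :
    (fun c => (combo X c ^ k).trace) ∈ generatedPoly X k := by
  choose E hdet hzero hnewton using fun c : ι → ℝ =>
    exists_newton (combo X c) (combo_transpose X c)
  suffices h : ∀ k, 0 < k → (fun c => (combo X c ^ k).trace) ∈ generatedPoly X k ∧
      (fun c => E c k) ∈ generatedPoly X k from (h k hk).1
  intro k
  induction k using Nat.strong_induction_on with
  | _ k ih =>
  intro hk
  set R : (ι → ℝ) → ℝ := fun c =>
    ∑ a ∈ Finset.HasAntidiagonal.antidiagonal k with a.1 ∈ Set.Ioo 0 k,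
      (-1) ^ a.1 * E c a.1 * (combo X c ^ a.2).trace with hR
  have hRmem : R ∈ generatedPoly X k := by
    have : R = ∑ a ∈ Finset.HasAntidiagonal.antidiagonal k with a.1 ∈ Set.Ioo 0 k,
        ((-1 : ℝ) ^ a.1) • ((fun c => E c a.1) * fun c => (combo X c ^ a.2).trace) := by
      funext c
      simp [hR, mul_assoc]
    rw [this]
    refine Submodule.sum_mem _ fun a ha => Submodule.smul_mem _ _ ?_
    rw [Finset.mem_filter, Finset.HasAntidiagonal.mem_antidiagonal] at ha
    obtain ⟨hsum, hpos, hlt⟩ := ha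
    exact mul_mem_generatedPoly hsum (ih a.1 hlt hpos).2 (ih a.2 (by omega) (by omega)).1
  have htr : (fun c => (combo X c ^ k).trace) =
      ((-1 : ℝ) ^ (k + 1) * k) • (fun c => E c k) - R := by
    funext c
    rw [hnewton c k hk]
    rfl
  have of_E : (fun c => E c k) ∈ generatedPoly X k →
      (fun c => (combo X c ^ k).trace) ∈ generatedPoly X k ∧
      (fun c => E c k) ∈ generatedPoly X k := fun hE =>
    ⟨htr ▸ Submodule.sub_mem _ (Submodule.smul_mem _ _ hE) hRmem, hE⟩
  rcases lt_trichotomy k (2 * l) with hlt | heq | hgt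
  · have ht : (fun c => (combo X c ^ k).trace) ∈ generatedPoly X k := by
      rcases Nat.even_or_odd k with he | ho
      · refine ⟨symTrace X k, .of (Or.inl ⟨k, he, ?_, ?_, rfl⟩), fun c => ?_⟩
        · obtain ⟨r, hr⟩ := he
          omega
        · obtain ⟨r, hr⟩ := he
          omega
        · rw [toPoly_symTrace, comboIn_real]
      · refine ⟨0, .zero k, fun c => ?_⟩
        rw [← symTrace_odd (X := X) ho, toPoly_symTrace, comboIn_real]
    refine ⟨ht, ?_⟩
    have hk0 : ((-1 : ℝ) ^ (k + 1) * k) ≠ 0 :=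
      mul_ne_zero (pow_ne_zero _ (by norm_num)) (by positivity)
    have : (fun c => E c k) = ((-1 : ℝ) ^ (k + 1) * k)⁻¹ •
        ((fun c => (combo X c ^ k).trace) + R) := by
      rw [htr, sub_add_cancel, smul_smul, inv_mul_cancel₀ hk0, one_smul]
    rw [this]
    exact Submodule.smul_mem _ _ (Submodule.add_mem _ ht hRmem)
  · refine of_E ?_
    subst heq
    have : (fun c => E c (2 * l)) =
        (fun c => pfaffian (combo X c)) * fun c => pfaffian (combo X c) := by
      funext c
      rw [hdet, det_eq_pfaffian_sq _ (combo_transpose X c), sq]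
      rfl
    rw [this]
    exact mul_mem_generatedPoly (two_mul l).symm pfaffian_mem_generatedPoly
      pfaffian_mem_generatedPoly
  · refine of_E ?_
    have : (fun c => E c k) = 0 := funext fun c => hzero c k hgt
    rw [this]
    exact Submodule.zero_mem _

lemma generatedBy_symTrace (hl : 1 ≤ l) {k : ℕ} (hk : 0 < k) :
    GeneratedBy (basicTensors X) k (symTrace X k) := by
  obtain ⟨t, ht, hF⟩ := trace_pow_mem_generatedPoly (X := X) k hk
  have : symTrace X k = t := (isSymmetric_symTrace X k).ext (ht.properties hl).1 fun c => by
    rw [hF, toPoly_symTrace, comboIn_real]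
  rwa [this]

end Generation

end EvenOrthogonal

end

theorem mainTheorem12 (l : ℕ) (hl : 1 ≤ l) {ι : Type*} [Fintype ι]
    (X : Module.Basis ι ℝ (EvenOrthogonal.D l)) :
    -- the symmetric traces are invariant symmetric tensors, and vanish in odd order
    (∀ m : ℕ, EvenOrthogonal.IsSymmetric (EvenOrthogonal.symTrace X m) ∧
      EvenOrthogonal.IsInvariant X (EvenOrthogonal.symTrace X m)) ∧
    (∀ m : ℕ, Odd m → EvenOrthogonal.symTrace X m = 0) ∧
    -- they are primitive exactly in the orders 2, 4, …, 2l - 2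
    (∀ m : ℕ, 1 ≤ m → (EvenOrthogonal.IsPrimitive X (EvenOrthogonal.symTrace X m) ↔
      Even m ∧ m ≤ 2 * l - 2)) ∧
    -- the Pfaffian tensor is the invariant symmetric tensor of the Pfaffian polynomial
    (EvenOrthogonal.IsSymmetric (EvenOrthogonal.pfTensor X) ∧
      EvenOrthogonal.IsInvariant X (EvenOrthogonal.pfTensor X) ∧
      ∀ c : ι → ℝ, EvenOrthogonal.pfaffian (EvenOrthogonal.combo X c) =
        ∑ i : Fin l → ι, EvenOrthogonal.pfTensor X i * ∏ s, c (i s)) ∧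
    -- the symmetric traces of higher order in terms of the basic ones and the Pfaffian tensor
    (∀ m : ℕ, Even m → 2 * l ≤ m →
      EvenOrthogonal.GeneratedBy (EvenOrthogonal.basicTensors X) m
        (EvenOrthogonal.symTrace X m)) ∧
    -- the determinant is the square of the Pfaffian
    (∀ c : ι → ℝ, (EvenOrthogonal.combo X c).det =
      EvenOrthogonal.pfaffian (EvenOrthogonal.combo X c) ^ 2) ∧
    -- the antisymmetrised product of 2l generators
    (∀ i : Fin (2 * l) → ι,
      ∑ α : Fin (2 * l) → Fin (2 * l), ∑ β : Fin (2 * l) → Fin (2 * l),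
          EvenOrthogonal.epsilon α β *
            ∏ s, (X (i s) : Matrix (Fin (2 * l)) (Fin (2 * l)) ℝ) (α s) (β s) =
        ((2 * l).factorial : ℝ) *
          EvenOrthogonal.symProd (two_mul l).symm (EvenOrthogonal.pfTensor X)
            (EvenOrthogonal.pfTensor X) i) := by
  open EvenOrthogonal in
  refine ⟨fun m => ⟨isSymmetric_symTrace X m, isInvariant_symTrace X m⟩,
    fun m hm => symTrace_odd X hm, fun m hm => ⟨fun hp => ?_, fun hp => ?_⟩,
    ⟨isSymmetric_pfTensor X, isInvariant_pfTensor X, fun c => (toPoly_pfTensor X c).symm⟩,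
    fun m _ hlm => generatedBy_symTrace hl (by omega),
    fun c => det_eq_pfaffian_sq _ (combo_transpose X c), fun i => congrFun (epsilonTensor_eq X) i⟩
  · obtain ⟨_, _, hnot⟩ := hp
    rcases Nat.even_or_odd m with he | ho
    · refine ⟨he, ?_⟩
      by_contra hgt
      obtain ⟨r, hr⟩ := he
      -- An even order above 2l - 2 is at least 2l, where generated tensors are decomposable.
      exact hnot (((generatedBy_symTrace hl hm).properties hl).2.2.2 (by omega))
    · rw [symTrace_odd X ho] at hnot
      exact absurd (Submodule.zero_mem _) hnot
  · obtain ⟨⟨j, rfl⟩, hle⟩ := hp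
    refine ⟨isSymmetric_symTrace X _, isInvariant_symTrace X _, ?_⟩
    rw [← two_mul]
    exact symTrace_notMem_decomposable (by omega) (by omega)
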